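/- Notation. An integer point is a point of $\mathbb Z^2$, and $O$ is the origin. For an angle with vertex $O$ smaller than a straight angle, let $C$ be its closed convex region and $K$ the convex hull of all integer points of $C$ other than $O$. The sail of the angle is the broken line $(A_i)$ formed by the successive vertices of $K$ along the boundary of $K$; it is finite, $A_0,\dots,A_n$, if both edges of the angle contain integer points other than $O$ (the two unbounded rays of the boundary are not counted), and two-sided infinite if neither edge does. The LLS sequence of the sail has the elements $$a_{2k}=\bigl|\det(OA_k,OA_{k+1})\bigr|,\qquad a_{2k-1}=\left|\frac{\det(A_kA_{k-1},A_kA_{k+1})}{a_{2k-2}\,a_{2k}}\right|$$ for all admissible $k$. For linearly independent integer vectors $P,Q$, $LLS(\angle POQ)$ is the finite sequence $(a_0,\dots,a_{2n-2})$ for the sail $A_0,\dots,A_n$ of $\angle POQ$ directed from the edge $OP$ to the edge $OQ$. Let $S_a=(a_1,\dots,a_m)$ and $S_b=(b_1,\dots,b_n)$ be finite sequences with $m>n$. The difference $S_a-S_b$ exists if there is $k$ with $1\le k\le n+1$ such that $b_i=a_i$ for $1\le i<k$, either $k=n+1$ or $b_k\ne a_k$, and $b_{k+i}=a_{k+i+m-n}$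 for $0\le i\le n-k$; then $S_a-S_b=(a_k,\dots,a_{k+m-n-1})$. Let $M\in GL(2,\mathbb Z)$ have two distinct real irrational eigenvalues. Its two eigenlines cut the plane into four cones. Direct the sail of each cone from a vertex $v$ towards $M^2(v)$. A finite sequence $(w_1,\dots,w_n)$ of positive integers, $n\ge1$, is an LLS period of $M$ if, for each of the four cones, $M^2$ shifts the sail by exactly $n$ vertices and the two-sided infinite LLS sequence of the sail is $(w_1,\dots,w_n)$ repeated periodically (up to a shift of the index). Proposition. Let $M\in GL(2,\mathbb Z)$ have two distinct real irrational eigenvalues (not necessarily positive), let $P_0$ be any nonzero integer point, and set $P_1=M^4(P_0)$ and $P_2=M^6(P_0)$. Then the difference $$LLS(\angle P_0OP_2)-LLS(\angle P_0OP_1)$$ exists, and it is an LLS period of $M$ repeated twice, that is, it equals $(w_1,\dots,w_n,w_1,\dots,w_n)$ for some LLS period $(w_1,\dots,w_n)$ of $M$. -/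

import Mathlib

namespace LLS

/-- Integer points of the plane. -/
abbrev IntPt : Type := Fin 2 → ℤ

/-- Points of the real plane (only its topology and its convex structure are used). -/
abbrev RealPt : Type := Fin 2 → ℝ

/-- An integer point, seen in the real plane. -/
def toReal (P : IntPt) : RealPt := fun i => (P i : ℝ)

/-- The determinant of a pair of integer vectors. -/
def det2 (u v : IntPt) : ℤ := u 0 * v 1 - u 1 * v 0

/-- The convex closure of the angle with vertex at the origin whose edges are spanned by
`u` and `v`. -/
def angle (u v : RealPt) : Set RealPt :=
  {x | ∃ s t : ℝ, 0 ≤ s ∧ 0 ≤ t ∧ x = s • u + t • v}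

/-- The convex hull of all integer points of `C` except the origin. -/
def hull (C : Set RealPt) : Set RealPt :=
  convexHull ℝ {x | x ∈ C ∧ x ≠ 0 ∧ ∃ P : IntPt, x = toReal P}

/-- The boundary of the convex hull of all integer points of `C` except the origin. -/
def sail (C : Set RealPt) : Set RealPt := frontier (hull C)

/-- The broken line with vertices `A i`, `i ∈ I` (with `I` an interval of `ℤ`), is the sail of `C`:
its vertices are the vertices (extreme points) of the convex hull, each listed once, and its edges,
which join consecutive vertices, lie on the boundary of the hull. (When the edges of the angle
contain integer points, that boundary also contains two unbounded rays on the edges of the angle,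
which do not belong to the finite broken line.) -/
def IsSailLine (C : Set RealPt) (I : Set ℤ) (A : ℤ → IntPt) : Prop :=
  Set.InjOn A I ∧
  (fun i => toReal (A i)) '' I = Set.extremePoints ℝ (hull C) ∧
  ∀ i, i ∈ I → i + 1 ∈ I → segment ℝ (toReal (A i)) (toReal (A (i + 1))) ⊆ sail C

/-- The element of the LLS sequence of a broken line that belongs to the edge `A k`, `A (k + 1)`. -/
def edgeTerm (A : ℤ → IntPt) (k : ℤ) : ℚ := (det2 (A k) (A (k + 1)) : ℚ)

/-- The element of the LLS sequence of a broken line that belongs to the vertex `A k`. -/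
def vertexTerm (A : ℤ → IntPt) (k : ℤ) : ℚ :=
  (det2 (A (k - 1) - A k) (A (k + 1) - A k) : ℚ) / (edgeTerm A (k - 1) * edgeTerm A k)

/-- The sequence of absolute values of the LLS sequence of a broken line: the element with index
`2 * k` belongs to the edge `A k`, `A (k + 1)`, that with index `2 * k - 1` to the vertex `A k`. -/
def absLLS (A : ℤ → IntPt) (j : ℤ) : ℚ :=
  if Even j then |edgeTerm A (j / 2)| else |vertexTerm A ((j + 1) / 2)|

/-- `S` is the LLS sequence of the rational angle `∠ P O Q`: the sail of the angle is the broken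
line `A 0, …, A n`, directed from the edge `OP` to the edge `OQ`, and `S` lists the `2 * n - 1`
absolute values of its LLS sequence. -/
def IsAngleLLS (P Q : IntPt) (S : List ℚ) : Prop :=
  ∃ (n : ℕ) (A : ℤ → IntPt),
    IsSailLine (angle (toReal P) (toReal Q)) (Set.Icc 0 (n : ℤ)) A ∧
    (∃ t : ℝ, 0 < t ∧ toReal (A 0) = t • toReal P) ∧
    (∃ t : ℝ, 0 < t ∧ toReal (A n) = t • toReal Q) ∧
    S = (List.range (2 * n - 1)).map (fun j : ℕ => absLLS A (j : ℤ))

/-- The difference `Sa - Sb` exists and is equal to `D`. Positions are counted from `0`;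
`k` is the first position at which `Sb` differs from `Sa`, or the length of `Sb`. -/
def IsDifference {α : Type*} (Sa Sb D : List α) : Prop :=
  Sb.length < Sa.length ∧
  ∃ k : ℕ, k ≤ Sb.length ∧
    (∀ i, i < k → Sb[i]? = Sa[i]?) ∧
    (k = Sb.length ∨ Sb[k]? ≠ Sa[k]?) ∧
    (∀ i, k ≤ i → i < Sb.length → Sb[i]? = Sa[i + (Sa.length - Sb.length)]?) ∧
    D = (Sa.drop k).take (Sa.length - Sb.length)

/-- The operator of the real plane defined by an integer matrix. -/
noncomputable def realOp (M : Matrix (Fin 2) (Fin 2) ℤ) : Module.End ℝ RealPt :=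
  Matrix.toLin' (M.map (Int.cast : ℤ → ℝ))

/-- `C` is (the closure of) one of the cones into which the eigenlines of `M` cut the plane. -/
def IsAssociatedCone (M : Matrix (Fin 2) (Fin 2) ℤ) (C : Set RealPt) : Prop :=
  ∃ (a b : ℝ) (u v : RealPt), a ≠ b ∧
    (realOp M).HasEigenvector a u ∧ (realOp M).HasEigenvector b v ∧ C = angle u v

/-- The two-sided infinite sequence `a` consists of the nonempty finite sequence `w` of positive
integers, repeated periodically. -/
def IsPeriodOf (w : List ℕ) (a : ℤ → ℚ) : Prop :=
  w ≠ [] ∧ (∀ x ∈ w, 0 < x) ∧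
  ∃ s : ℤ, ∀ (q : ℤ) (i : Fin w.length),
    a (s + q * (w.length : ℤ) + ((i : ℕ) : ℤ)) = (w.get i : ℚ)

/-- `w` is an LLS period of `M`: the sail of each associated cone is a two-sided infinite broken
line which, directed from a vertex to its image under `M ^ 2`, is shifted by `M ^ 2` by exactly
`n` vertices, where `n` is the length of `w`, and `w` is a period of its LLS sequence. -/
def IsLLSPeriod (M : Matrix (Fin 2) (Fin 2) ℤ) (w : List ℕ) : Prop :=
  ∀ C : Set RealPt, IsAssociatedCone M C →
    ∃ A : ℤ → IntPt, IsSailLine C Set.univ A ∧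
      (∀ i : ℤ, (M ^ 2).mulVec (A i) = A (i + (w.length : ℤ))) ∧
      IsPeriodOf w (absLLS A)

end LLS

/-!
Let `F`, `G` be the left eigenvectors of `M`, as linear forms, with `G` the expanded one. Neither
vanishes at a nonzero lattice point. A lattice basis `(x, y)` is *reduced* if `F` alternates in sign
and decreases in absolute value from `x` to `y` while `G` is positive and increases. The box spanned
by a reduced basis contains no other lattice points (`IsReduced.box`), so reduced bases have unique
successors and predecessors and all of them lie on one two-sided chain
`v (j + 2) = v j + a j • v (j + 1)`, `a j ≥ 1`. As `M` or `-M` permutes the reduced bases, it shifts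
this chain, by `n` steps say, so that `a` has period `n` (`exists_isBichain`).

The vectors `v (2 * k)` are the vertices of the sail of one of the four cones: the edges of this
broken line have the directions `v (2 * k + 1)`, which lie in the adjacent cone, so the edges
lie on supporting lines at integer distance one (`isSailLine_of_supported`). The vectors of odd index
form the sail of the adjacent cone in the same way. In both cases the LLS sequence is the sequence
`a` (`IsBichain.absLLS_eq`), which makes every window of length `n` of `a` an LLS period.

For a primitive vector `P` of the cone, the sail of the angle from `P` to `(M ^ 2) ^ k P` is a locally
convex chain glued from three parts: the sail from `P` to the next vertex of the sail of the cone,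
a piece of the latter, and an end part that is the image under `(M ^ 2) ^ k` of a fixed chain
(`exists_angle_chains`). Passing from `k = 2` to `k = 3` thus inserts `n` vertices, or `2 * n`
consecutive entries of `a`, into the LLS sequence. The difference of the two sequences is a rotation
of the inserted block (`exists_isDifference`), hence a window of length `n` of `a` taken twice.
-/

namespace LLS

/-! ### A criterion for a broken line to be a sail -/

@[simp] theorem toReal_apply (x : IntPt) (i : Fin 2) : toReal x i = (x i : ℝ) := rfl

theorem toReal_injective : Function.Injective toReal := fun x y h => by
  funext i
  have := congrFun h i
  simpa using this

theorem toReal_eq_zero {x : IntPt} : toReal x = 0 ↔ x = 0 := by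
  constructor
  · intro h
    apply toReal_injective
    rw [h]
    ext i
    simp
  · rintro rfl
    ext i
    simp

theorem toReal_zsmul (m : ℤ) (x : IntPt) : toReal (m • x) = (m : ℝ) • toReal x := by
  ext i
  simp

/-- The real linear functional `x ↦ det (x, d)`. -/
noncomputable def detWith (d : IntPt) : RealPt →ₗ[ℝ] ℝ :=
  (d 1 : ℝ) • LinearMap.proj 0 - (d 0 : ℝ) • LinearMap.proj 1

theorem detWith_apply (d : IntPt) (x : RealPt) : detWith d x = x 0 * d 1 - x 1 * d 0 := by
  simp [detWith, mul_comm]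

@[simp] theorem detWith_toReal (d x : IntPt) : detWith d (toReal x) = (det2 x d : ℝ) := by
  simp [detWith_apply, det2]

theorem toReal_mem_hull {C : Set RealPt} {x : IntPt} (hx : toReal x ∈ C) (h0 : x ≠ 0) :
    toReal x ∈ hull C :=
  subset_convexHull ℝ _ ⟨hx, fun h => h0 (toReal_eq_zero.1 h), x, rfl⟩

theorem le_of_mem_hull {C : Set RealPt} {L : RealPt →ₗ[ℝ] ℝ} {c : ℝ}
    (h : ∀ x : IntPt, toReal x ∈ C → x ≠ 0 → c ≤ L (toReal x)) {y : RealPt} (hy : y ∈ hull C) :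
    c ≤ L y := by
  have hsub : hull C ⊆ {y | c ≤ L y} := by
    refine convexHull_min ?_ (convex_halfSpace_ge L.isLinear c)
    rintro _ ⟨hC, h0, P, rfl⟩
    exact h P hC fun hP => h0 (toReal_eq_zero.2 hP)
  exact hsub hy

theorem mem_frontier_of_minimal {H : Set RealPt} {L : RealPt →ₗ[ℝ] ℝ} {x w : RealPt}
    (hx : x ∈ H) (hmin : ∀ y ∈ H, L x ≤ L y) (hw : 0 < L w) : x ∈ frontier H := by
  refine ⟨subset_closure hx, fun hint => ?_⟩
  have hc : Filter.Tendsto (fun t : ℝ => x - t • w) (nhdsWithin 0 (Set.Ioi 0)) (nhds x) := by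
    have : Continuous fun t : ℝ => x - t • w := by fun_prop
    simpa using (this.tendsto 0).mono_left nhdsWithin_le_nhds
  have hev := hc.eventually (mem_interior_iff_mem_nhds.1 hint)
  obtain ⟨t, ht, ht0⟩ := (hev.and self_mem_nhdsWithin).exists
  have h1 := hmin _ ht
  have h2 : 0 < t * L w := mul_pos ht0 hw
  simp only [map_sub, map_smul, smul_eq_mul] at h1
  linarith

/-- A point at which two linearly independent functionals attain their minimum is extreme. -/
theorem mem_extremePoints_of_minimal {H : Set RealPt} {L L' : RealPt →ₗ[ℝ] ℝ} {x : RealPt}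
    (hx : x ∈ H) (h : ∀ y ∈ H, L x ≤ L y) (h' : ∀ y ∈ H, L' x ≤ L' y)
    (hsep : ∀ y, L y = L x → L' y = L' x → y = x) : x ∈ Set.extremePoints ℝ H := by
  have key : ∀ (l : RealPt →ₗ[ℝ] ℝ) (y z : RealPt), l x ≤ l y → l x ≤ l z →
      x ∈ openSegment ℝ y z → l y = l x := by
    rintro l y z hy hz ⟨s, t, hs, ht, hst, rfl⟩
    simp only [map_add, map_smul, smul_eq_mul] at *
    have e : t = 1 - s := by linarith
    subst e
    nlinarith
  rw [mem_extremePoints]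
  refine ⟨hx, fun y hy z hz hseg => ⟨?_, ?_⟩⟩
  · exact hsep y (key L y z (h y hy) (h z hz) hseg) (key L' y z (h' y hy) (h' z hz) hseg)
  · rw [openSegment_symm] at hseg
    exact hsep z (key L z y (h z hz) (h y hy) hseg) (key L' z y (h' z hz) (h' y hy) hseg)

/-- If the lattice points `P`, `Q` span a sector containing the lattice point `x`, and the edge
`PQ` lies on a line `det (·, e) = 1` below which there are no lattice points of `C`, then `x` is
extreme in the hull only if it is `P` or `Q`. -/
theorem eq_or_eq_of_mem_extremePoints {C : Set RealPt} {P Q e x : IntPt} {a σ : ℤ}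
    (hscale : toReal x ∈ C → toReal ((2 : ℤ) • x) ∈ C)
    (hP : toReal P ∈ hull C) (hQ : toReal Q ∈ hull C) (ha : 0 < a)
    (hPe : σ * det2 P e = 1) (hQP : Q = P + a • e) (hxe : 0 < σ * det2 x e)
    (hxC : toReal x ∈ C) (hx0 : x ≠ 0)
    (h1 : 0 ≤ σ * det2 P x) (h2 : 0 ≤ σ * det2 x Q)
    (hx : toReal x ∈ Set.extremePoints ℝ (hull C)) : x = P ∨ x = Q := by
  obtain ⟨hxH, hext⟩ := mem_extremePoints_iff_forall_segment.1 hx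
  set s := σ * det2 x Q with hs
  set t := σ * det2 P x with ht
  have hcr : ∀ i, a * x i = s * P i + t * Q i := by
    intro i
    subst hQP
    have : a * x i = (σ * det2 P e) * (a * x i) := by rw [hPe]; ring
    rw [this, hs, ht]
    simp only [det2, Pi.add_apply, Pi.smul_apply, smul_eq_mul]
    fin_cases i <;> simp <;> ring
  have hst : s + t = a * (σ * det2 x e) := by
    have e1 : s = σ * det2 x P + a * (σ * det2 x e) := by
      rw [hs, hQP]
      simp only [det2, Pi.add_apply, Pi.smul_apply, smul_eq_mul]
      ring
    rw [e1, ht]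
    simp only [det2]
    ring
  have hle : a ≤ s + t := by rw [hst]; nlinarith
  have hpos : (0 : ℝ) < (s : ℝ) + t := by exact_mod_cast ha.trans_le hle
  have hstR : ((s + t : ℤ) : ℝ) = (s : ℝ) + t := by push_cast; ring
  have hcrR : ∀ i, (a : ℝ) * x i = s * P i + t * Q i := fun i => by exact_mod_cast hcr i
  have hsR : (0 : ℝ) ≤ s := by exact_mod_cast h2
  have htR : (0 : ℝ) ≤ t := by exact_mod_cast h1
  -- the point at which the ray through `x` meets the edge
  have hy : ((a : ℝ) / (s + t)) • toReal x ∈ segment ℝ (toReal P) (toReal Q) := by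
    refine ⟨s / (s + t), t / (s + t), by positivity, by positivity, by field_simp, ?_⟩
    ext i
    simp only [Pi.add_apply, Pi.smul_apply, smul_eq_mul, toReal_apply]
    have := hcrR i
    field_simp
    linarith
  rcases hle.eq_or_lt with heq | hlt
  · have h1 : (a : ℝ) / (s + t) = 1 := by
      rw [← hstR, ← heq]
      have : (a : ℝ) ≠ 0 := by exact_mod_cast ha.ne'
      field_simp
    rw [h1, one_smul] at hy
    rcases hext _ hP _ hQ hy with h | h
    · exact Or.inl (toReal_injective h).symm
    · exact Or.inr (toReal_injective h).symm
  · exfalso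
    have hyH : ((a : ℝ) / (s + t)) • toReal x ∈ hull C :=
      (convex_convexHull ℝ _).segment_subset hP hQ hy
    have h2x : toReal ((2 : ℤ) • x) ∈ hull C := by
      refine toReal_mem_hull (hscale hxC) ?_
      exact smul_ne_zero two_ne_zero hx0
    have hxr : toReal x ≠ 0 := fun h => hx0 (toReal_eq_zero.1 h)
    have hr1 : (a : ℝ) / (s + t) < 1 := by
      rw [div_lt_one hpos]
      exact_mod_cast hlt
    set r := (a : ℝ) / (s + t) with hr
    have hseg : toReal x ∈ segment ℝ (r • toReal x) (toReal ((2 : ℤ) • x)) := by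
      refine ⟨1 / (2 - r), (1 - r) / (2 - r), ?_, ?_, ?_, ?_⟩
      · exact div_nonneg zero_le_one (by linarith)
      · exact div_nonneg (by linarith) (by linarith)
      · have : 2 - r ≠ 0 := by linarith
        field_simp
        ring
      · have : 2 - r ≠ 0 := by linarith
        ext i
        simp only [toReal_zsmul, Pi.add_apply, Pi.smul_apply, smul_eq_mul, toReal_apply]
        push_cast
        field_simp
        ring
    rcases hext _ hyH _ h2x hseg with h | h
    · have : (r - 1) • toReal x = 0 := by rw [sub_smul, h, one_smul, sub_self]
      rcases smul_eq_zero.1 this with h' | h'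
      · linarith
      · exact hxr h'
    · have h3 := toReal_injective h
      rw [two_smul] at h3
      exact hx0 (by simpa using h3)

/-- A broken line is the sail of `C` if each edge lies on a line at integer distance one from the
origin with all of `C` on its far side, each vertex minimises two independent functionals,
and the sectors spanned by the edges cover the lattice points of `C`. -/
theorem isSailLine_of_supported {C : Set RealPt} {I : Set ℤ} {A e : ℤ → IntPt} {a : ℤ → ℤ} {σ : ℤ}
    (hmem : ∀ k ∈ I, toReal (A k) ∈ C) (hne : ∀ k ∈ I, A k ≠ 0)
    (hscale : ∀ x : IntPt, toReal x ∈ C → toReal ((2 : ℤ) • x) ∈ C)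
    (hinj : Set.InjOn A I)
    (hedge : ∀ k ∈ I, k + 1 ∈ I → 0 < a k ∧ σ * det2 (A k) (e k) = 1 ∧
      A (k + 1) = A k + a k • e k ∧ ∀ x, toReal x ∈ C → x ≠ 0 → 0 < σ * det2 x (e k))
    (hvert : ∀ k ∈ I, ∃ d d', det2 d d' ≠ 0 ∧ ∀ x, toReal x ∈ C → x ≠ 0 →
      σ * det2 (A k) d ≤ σ * det2 x d ∧ σ * det2 (A k) d' ≤ σ * det2 x d')
    (hcov : ∀ x, toReal x ∈ C → x ≠ 0 → ∃ k ∈ I, k + 1 ∈ I ∧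
      0 ≤ σ * det2 (A k) x ∧ 0 ≤ σ * det2 x (A (k + 1)))
    (hσ : σ ≠ 0) :
    IsSailLine C I A := by
  have hH : ∀ k ∈ I, toReal (A k) ∈ hull C := fun k hk => toReal_mem_hull (hmem k hk) (hne k hk)
  refine ⟨hinj, Set.Subset.antisymm ?_ ?_, ?_⟩
  · rintro _ ⟨k, hk, rfl⟩
    obtain ⟨d, d', hdd, hd⟩ := hvert k hk
    refine mem_extremePoints_of_minimal (L := (σ : ℝ) • detWith d) (L' := (σ : ℝ) • detWith d')
      (hH k hk) (fun y hy => ?_) (fun y hy => ?_) ?_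
    · refine le_of_mem_hull (fun x hx h0 => ?_) hy
      simp only [LinearMap.smul_apply, detWith_toReal, smul_eq_mul]
      exact_mod_cast (hd x hx h0).1
    · refine le_of_mem_hull (fun x hx h0 => ?_) hy
      simp only [LinearMap.smul_apply, detWith_toReal, smul_eq_mul]
      exact_mod_cast (hd x hx h0).2
    · intro y h1 h2
      have hσ' : (σ : ℝ) ≠ 0 := by exact_mod_cast hσ
      simp only [LinearMap.smul_apply, smul_eq_mul, mul_right_inj' hσ', detWith_apply] at h1 h2
      have hdd' : (d 0 : ℝ) * d' 1 - d 1 * d' 0 ≠ 0 := by exact_mod_cast hdd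
      ext i
      apply mul_left_cancel₀ hdd'
      fin_cases i
      · simp only [Fin.zero_eta, Fin.isValue]
        linear_combination (d 0 : ℝ) * h2 - d' 0 * h1
      · simp only [Fin.mk_one, Fin.isValue]
        linear_combination (d 1 : ℝ) * h2 - d' 1 * h1
  · intro y hy
    obtain ⟨hyC, hy0, x, rfl⟩ := extremePoints_convexHull_subset hy
    have hx0 : x ≠ 0 := fun h => hy0 (toReal_eq_zero.2 h)
    obtain ⟨k, hk, hk1, h1, h2⟩ := hcov x hyC hx0
    obtain ⟨ha, hAe, hA, hs⟩ := hedge k hk hk1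
    rcases eq_or_eq_of_mem_extremePoints (hscale x) (hH k hk) (hH _ hk1) ha hAe hA (hs x hyC hx0)
      hyC hx0 h1 h2 hy with rfl | rfl
    · exact ⟨k, hk, rfl⟩
    · exact ⟨k + 1, hk1, rfl⟩
  · intro k hk hk1 y hy
    obtain ⟨ha, hAe, hA, hs⟩ := hedge k hk hk1
    have hyH := (convex_convexHull ℝ _).segment_subset (hH k hk) (hH _ hk1) hy
    have e1 : ((σ : ℝ) • detWith (e k)) (toReal (A k)) = 1 := by
      simp only [LinearMap.smul_apply, detWith_toReal, smul_eq_mul]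
      exact_mod_cast hAe
    have e2 : ((σ : ℝ) • detWith (e k)) (toReal (A (k + 1))) = 1 := by
      simp only [LinearMap.smul_apply, detWith_toReal, smul_eq_mul]
      have : σ * det2 (A (k + 1)) (e k) = 1 := by
        rw [hA]
        refine Eq.trans ?_ hAe
        simp only [det2, Pi.add_apply, Pi.smul_apply, smul_eq_mul]
        ring
      exact_mod_cast this
    have e3 : ((σ : ℝ) • detWith (e k)) y = 1 := by
      obtain ⟨s, t, -, -, hst, rfl⟩ := hy
      rw [map_add, map_smul, map_smul, e1, e2]
      simpa using hst
    refine mem_frontier_of_minimal (L := (σ : ℝ) • detWith (e k)) (w := toReal (A k)) hyH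
      (fun z hz => ?_) (by rw [e1]; exact one_pos)
    rw [e3]
    refine le_of_mem_hull (fun x hx h0 => ?_) hz
    simp only [LinearMap.smul_apply, detWith_toReal, smul_eq_mul]
    exact_mod_cast hs x hx h0

/-! ### Reduced bases and their two-sided chains -/

theorem det2_add_left (x y z : IntPt) : det2 (x + y) z = det2 x z + det2 y z := by
  simp only [det2, Pi.add_apply]; ring

theorem det2_add_right (x y z : IntPt) : det2 z (x + y) = det2 z x + det2 z y := by
  simp only [det2, Pi.add_apply]; ring

theorem det2_sub_left (x y z : IntPt) : det2 (x - y) z = det2 x z - det2 y z := by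
  simp only [det2, Pi.sub_apply]; ring

theorem det2_sub_right (x y z : IntPt) : det2 z (x - y) = det2 z x - det2 z y := by
  simp only [det2, Pi.sub_apply]; ring

theorem det2_neg_left (x z : IntPt) : det2 (-x) z = -det2 x z := by
  simp only [det2, Pi.neg_apply]; ring

theorem det2_neg_right (x z : IntPt) : det2 z (-x) = -det2 z x := by
  simp only [det2, Pi.neg_apply]; ring

theorem det2_smul_left (m : ℤ) (x z : IntPt) : det2 (m • x) z = m * det2 x z := by
  simp only [det2, Pi.smul_apply, smul_eq_mul]; ring

theorem det2_smul_right (m : ℤ) (x z : IntPt) : det2 z (m • x) = m * det2 z x := by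
  simp only [det2, Pi.smul_apply, smul_eq_mul]; ring

@[simp] theorem det2_self (x : IntPt) : det2 x x = 0 := by
  simp only [det2]; ring

@[simp] theorem det2_zero_left (x : IntPt) : det2 0 x = 0 := by
  simp [det2]

theorem det2_comm (x y : IntPt) : det2 x y = -det2 y x := by
  simp only [det2]; ring

/-- Cramer's rule. -/
theorem det2_smul_eq (x y z : IntPt) : det2 x y • z = det2 z y • x + det2 x z • y := by
  ext i
  simp only [det2, Pi.add_apply, Pi.smul_apply, smul_eq_mul]
  fin_cases i <;> simp <;> ring

theorem exists_det2_eq_one {x : IntPt} (h : IsCoprime (x 0) (x 1)) : ∃ y, det2 x y = 1 := by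
  obtain ⟨a, b, hab⟩ := h
  refine ⟨![-b, a], ?_⟩
  simp only [det2, Matrix.cons_val_zero, Matrix.cons_val_one]
  linarith

theorem exists_eq_smul_isCoprime {x : IntPt} (hx : x ≠ 0) :
    ∃ (m : ℤ) (y : IntPt), 0 < m ∧ x = m • y ∧ IsCoprime (y 0) (y 1) := by
  have hne : x 0 ≠ 0 ∨ x 1 ≠ 0 := by
    by_contra! h
    apply hx
    ext i
    fin_cases i
    · exact h.1
    · exact h.2
  have hg : 0 < Int.gcd (x 0) (x 1) := Int.gcd_pos_iff.2 hne
  obtain ⟨p, q, hpq, h0, h1⟩ := Int.exists_gcd_one hg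
  refine ⟨(Int.gcd (x 0) (x 1) : ℤ), ![p, q], by exact_mod_cast hg, ?_, ?_⟩
  · ext i
    fin_cases i
    · simpa [mul_comm] using h0
    · simpa [mul_comm] using h1
  · simpa using Int.isCoprime_iff_gcd_eq_one.2 hpq

/-- Two real coordinates on the integer lattice, neither of which vanishes at a nonzero
lattice point; `c` is the ratio of the area form in these coordinates to the determinant. In the
application they are the eigenforms of a hyperbolic matrix. -/
structure IsIrrationalFrame (f g : IntPt →+ ℝ) (c : ℝ) : Prop where
  eq_zero_left : ∀ x, f x = 0 → x = 0
  eq_zero_right : ∀ x, g x = 0 → x = 0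
  ne_zero : c ≠ 0
  wedge : ∀ x y, f x * g y - f y * g x = c * det2 x y

/-- A lattice basis `(x, y)` is reduced if the values of `f` alternate in sign and decrease in
absolute value while those of `g` are positive and increase. -/
structure IsReduced (f g : IntPt →+ ℝ) (x y : IntPt) : Prop where
  det : det2 x y = 1 ∨ det2 x y = -1
  neg : f y / f x < 0
  gt : -1 < f y / f x
  pos : 0 < g x
  lt : g x < g y

section

variable {f g : IntPt →+ ℝ} {c : ℝ}

theorem IsReduced.f_ne_zero {x y : IntPt} (h : IsReduced f g x y) : f x ≠ 0 := by
  intro h0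
  have := h.neg
  simp [h0] at this

theorem IsReduced.abs_right_lt {x y : IntPt} (h : IsReduced f g x y) : |f y| < |f x| := by
  have h1 : |f y / f x| < 1 := by
    rw [abs_lt]
    exact ⟨h.gt, h.neg.trans one_pos⟩
  rwa [abs_div, div_lt_one (abs_pos.2 h.f_ne_zero)] at h1

theorem IsReduced.mul_lt_zero {x y : IntPt} (h : IsReduced f g x y) : f y * f x < 0 := by
  have h1 := h.neg
  have h2 : 0 < f x * f x := mul_self_pos.2 h.f_ne_zero
  have : f y * f x = f y / f x * (f x * f x) := by
    field_simp [h.f_ne_zero]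
  rw [this]
  exact mul_neg_of_neg_of_pos h1 h2

theorem map_zsmul_real (f : IntPt →+ ℝ) (m : ℤ) (x : IntPt) : f (m • x) = m * f x := by
  rw [map_zsmul, zsmul_eq_mul]

/-- The box spanned by a reduced basis contains no nonzero lattice point. -/
theorem IsReduced.box {x y z : IntPt} (h : IsReduced f g x y) (hz : z ≠ 0) :
    |f x| ≤ |f z| ∨ g y ≤ |g z| := by
  obtain ⟨p, q, rfl⟩ : ∃ p q : ℤ, z = p • x + q • y := by
    have hc := det2_smul_eq x y z
    rcases h.det with hd | hd
    · exact ⟨det2 z y, det2 x z, by simpa [hd] using hc⟩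
    · refine ⟨-det2 z y, -det2 x z, ?_⟩
      rw [hd] at hc
      rw [neg_smul, neg_smul, ← neg_add, ← hc]
      simp
  simp only [map_add, map_zsmul_real]
  have hgx := h.pos
  have hgy : 0 < g y := hgx.trans h.lt
  have hone : ∀ m : ℤ, m ≠ 0 → (1 : ℝ) ≤ |(m : ℝ)| := fun m hm => by
    exact_mod_cast Int.one_le_abs hm
  have hprod : ∀ m : ℤ, m ≠ 0 → ∀ r : ℝ, |r| ≤ |(m : ℝ) * r| := fun m hm r => by
    rw [abs_mul]
    exact le_mul_of_one_le_left (abs_nonneg r) (hone m hm)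
  by_cases hq : q = 0
  · subst hq
    have hp : p ≠ 0 := by
      rintro rfl
      simp at hz
    left
    simpa using hprod p hp (f x)
  by_cases hp : p = 0
  · subst hp
    right
    simpa [abs_of_pos hgy] using hprod q hq (g y)
  rcases (mul_ne_zero hp hq).lt_or_gt with hpq | hpq
  · left
    have hneg := h.mul_lt_zero
    have hpqR : (p : ℝ) * q < 0 := by exact_mod_cast hpq
    have h2 : 0 < ((p : ℝ) * f x) * (q * f y) := by nlinarith
    refine (hprod p hp (f x)).trans ?_
    rw [← sq_le_sq]
    nlinarith [sq_nonneg ((q : ℝ) * f y)]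
  · right
    have hpqR : 0 < (p : ℝ) * q := by exact_mod_cast hpq
    have h2 : 0 < ((p : ℝ) * g x) * (q * g y) := by
      have := mul_pos hpqR (mul_pos hgx hgy)
      nlinarith
    have h3 := hprod q hq (g y)
    rw [abs_of_pos hgy] at h3
    refine h3.trans ?_
    rw [← sq_le_sq]
    nlinarith [sq_nonneg ((p : ℝ) * g x)]

variable (hfg : IsIrrationalFrame f g c)
include hfg

theorem IsIrrationalFrame.eq_of_abs_eq {x y : IntPt} (hx : 0 < g x) (hy : 0 < g y)
    (h : |f x| = |f y|) : x = y := by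
  rcases abs_eq_abs.1 h with h | h
  · exact sub_eq_zero.1 (hfg.eq_zero_left _ (by rw [map_sub, h, sub_self]))
  · have h1 : x + y = 0 := hfg.eq_zero_left _ (by rw [map_add, h, neg_add_cancel])
    have h2 : g x + g y = 0 := by rw [← map_add, h1, map_zero]
    linarith

theorem IsReduced.right_unique {x y z : IntPt} (hy : IsReduced f g x y)
    (hz : IsReduced f g x z) : y = z := by
  have key : ∀ {y z}, IsReduced f g x y → IsReduced f g x z → g y ≤ g z := by
    intro y z hy hz
    have hgz : 0 < g z := hz.pos.trans hz.lt
    have hz0 : z ≠ 0 := by rintro rfl; simp at hgz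
    rcases hy.box hz0 with h | h
    · exact absurd h (not_le.2 hz.abs_right_lt)
    · rwa [abs_of_pos hgz] at h
  have h : g y = g z := le_antisymm (key hy hz) (key hz hy)
  exact sub_eq_zero.1 (hfg.eq_zero_right _ (by rw [map_sub, h, sub_self]))

theorem IsReduced.left_unique {x y z : IntPt} (hx : IsReduced f g x z)
    (hy : IsReduced f g y z) : x = y := by
  have key : ∀ {x y}, IsReduced f g x z → IsReduced f g y z → |f x| ≤ |f y| := by
    intro x y hx hy
    have hy0 : y ≠ 0 := by rintro rfl; simpa using hy.pos
    rcases hx.box hy0 with h | h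
    · exact h
    · rw [abs_of_pos hy.pos] at h
      exact absurd h (not_le.2 hy.lt)
  exact hfg.eq_of_abs_eq hx.pos hy.pos (le_antisymm (key hx hy) (key hy hx))

theorem IsReduced.exists_next {x y : IntPt} (h : IsReduced f g x y) :
    ∃ (a : ℕ) (z : IntPt), 0 < a ∧ z = x + (a : ℤ) • y ∧ IsReduced f g y z := by
  have hfx := h.f_ne_zero
  have hfy : f y ≠ 0 := by
    intro h0
    have := h.neg
    simp [h0] at this
  set r : ℝ := -(f x / f y) with hr
  have hr1 : 1 < r := by
    have h1 : f y / f x * (f x / f y) = 1 := by field_simp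
    have h2 := h.gt
    have h3 := h.neg
    have h4 : 0 < r := by
      by_contra! h5
      nlinarith
    nlinarith
  have hfl : 0 < ⌊r⌋ := Int.floor_pos.2 hr1.le
  obtain ⟨a, ha⟩ := Int.eq_ofNat_of_zero_le hfl.le
  refine ⟨a, x + (a : ℤ) • y, by omega, rfl, ?_⟩
  have hdet : det2 y (x + (a : ℤ) • y) = -det2 x y := by
    rw [det2_add_right, det2_smul_right, det2_self, det2_comm]; ring
  have hz0 : f (x + (a : ℤ) • y) ≠ 0 := by
    intro h0
    rw [hfg.eq_zero_left _ h0, det2_comm, det2_zero_left] at hdet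
    rcases h.det with h1 | h1 <;> omega
  have hz : f (x + (a : ℤ) • y) / f y = ⌊r⌋ - r := by
    rw [map_add, map_zsmul_real, ha, hr]
    push_cast
    field_simp
    ring
  have hgy : 0 < g y := h.pos.trans h.lt
  refine ⟨?_, ?_, ?_, hgy, ?_⟩
  · rw [hdet]
    rcases h.det with h1 | h1 <;> omega
  · have h1 : f (x + (a : ℤ) • y) / f y ≠ 0 := div_ne_zero hz0 hfy
    refine lt_of_le_of_ne ?_ h1
    rw [hz]
    linarith [Int.floor_le r]
  · rw [hz]
    linarith [Int.lt_floor_add_one r]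
  · rw [map_add, map_zsmul_real]
    have : (1 : ℝ) ≤ (a : ℤ) := by
      rw [← ha]
      exact_mod_cast hfl
    nlinarith [h.pos]

theorem IsReduced.exists_prev {x y : IntPt} (h : IsReduced f g x y) :
    ∃ z : IntPt, IsReduced f g z x := by
  have hfx := h.f_ne_zero
  have hgx := h.pos
  set r : ℝ := g y / g x with hr
  have hr1 : 1 < r := by
    rw [hr, one_lt_div hgx]
    exact h.lt
  have hfl : 0 < ⌊r⌋ := Int.floor_pos.2 hr1.le
  have hflR : (1 : ℝ) ≤ ⌊r⌋ := by exact_mod_cast hfl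
  have hry : g y = r * g x := by
    rw [hr]
    field_simp
  set z := y - ⌊r⌋ • x with hz
  have hdet : det2 z x = -det2 x y := by
    rw [hz, det2_sub_left, det2_smul_left, det2_self, det2_comm]; ring
  have hgz : g z = (r - ⌊r⌋) * g x := by
    rw [hz, map_sub, map_zsmul_real, hry]
    ring
  have hz0 : g z ≠ 0 := by
    intro h0
    rw [hfg.eq_zero_right _ h0, det2_zero_left] at hdet
    rcases h.det with h1 | h1 <;> omega
  have hfz : f z = (f y / f x - ⌊r⌋) * f x := by
    rw [hz, map_sub, map_zsmul_real]
    field_simp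
  have hlt : f y / f x - ⌊r⌋ < -1 := by linarith [h.neg]
  have hq : f x / f z = 1 / (f y / f x - ⌊r⌋) := by
    rw [hfz]
    field_simp
  refine ⟨z, ?_, ?_, ?_, ?_, ?_⟩
  · rw [hdet]
    rcases h.det with h1 | h1 <;> omega
  · rw [hq]
    exact div_neg_of_pos_of_neg one_pos (by linarith)
  · rw [hq, lt_div_iff_of_neg (by linarith)]
    linarith
  · refine lt_of_le_of_ne ?_ hz0.symm
    rw [hgz]
    exact mul_nonneg (by linarith [Int.floor_le r]) hgx.le
  · rw [hgz]
    have : r - ⌊r⌋ < 1 := by linarith [Int.lt_floor_add_one r]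
    nlinarith

/-- A reduced basis: its first vector is a lattice point of a strip `|f| < L` with minimal `|g|`. -/
theorem IsIrrationalFrame.exists_isReduced : ∃ x y, IsReduced f g x y := by
  let E : IntPt := ![1, 0]
  let E' : IntPt := ![0, 1]
  have hE : E ≠ 0 := fun h => by simpa [E] using congrFun h 0
  set T : Set IntPt := {x | x ≠ 0 ∧ |f x| < |f E| + 1 ∧ |g x| ≤ |g E|} with hT
  have hfin : T.Finite := by
    obtain ⟨B, hB⟩ : ∃ B : ℝ, B = ((|f E| + 1) * (|g E| + |g E'|) + |g E| * (|f E| + |f E'|)) / |c| :=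
      ⟨_, rfl⟩
    have hc : 0 < |c| := abs_pos.2 hfg.ne_zero
    have hbd : ∀ x ∈ T, ∀ y, (y = E ∨ y = E') → |(det2 x y : ℝ)| ≤ B := by
      rintro x ⟨-, hfx, hgx⟩ y hy
      rw [hB, le_div_iff₀ hc, mul_comm, ← abs_mul, ← hfg.wedge]
      have hgy : |g y| ≤ |g E| + |g E'| := by
        rcases hy with rfl | rfl <;> linarith [abs_nonneg (g E), abs_nonneg (g E')]
      have hfy : |f y| ≤ |f E| + |f E'| := by
        rcases hy with rfl | rfl <;> linarith [abs_nonneg (f E), abs_nonneg (f E')]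
      calc |f x * g y - f y * g x| ≤ |f x * g y| + |f y * g x| := abs_sub _ _
        _ = |f x| * |g y| + |g x| * |f y| := by rw [abs_mul, abs_mul, mul_comm |f y|]
        _ ≤ _ := by gcongr
    have hsub : T ⊆ Set.Icc (fun _ => -⌈B⌉) (fun _ => ⌈B⌉) := by
      intro x hx
      have h0 : |x 0| ≤ ⌈B⌉ := by
        have := hbd x hx E' (Or.inr rfl)
        simp only [det2, E', Matrix.cons_val_zero, Matrix.cons_val_one, mul_one, mul_zero,
          sub_zero] at this
        exact_mod_cast this.trans (Int.le_ceil B)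
      have h1 : |x 1| ≤ ⌈B⌉ := by
        have := hbd x hx E (Or.inl rfl)
        simp only [det2, E, Matrix.cons_val_zero, Matrix.cons_val_one, mul_one, mul_zero,
          zero_sub, Int.cast_neg, abs_neg] at this
        exact_mod_cast this.trans (Int.le_ceil B)
      constructor <;> intro i <;> fin_cases i
      · exact (abs_le.1 h0).1
      · exact (abs_le.1 h1).1
      · exact (abs_le.1 h0).2
      · exact (abs_le.1 h1).2
    exact (Set.finite_Icc _ _).subset hsub
  obtain ⟨x₁, hx₁, hmin₁⟩ := Set.exists_min_image T (fun x => |g x|) hfin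
    ⟨E, hE, by linarith, le_rfl⟩
  obtain ⟨x, hx0, hfx, hgx, hmin⟩ : ∃ x, x ≠ 0 ∧ |f x| < |f E| + 1 ∧ 0 < g x ∧
      ∀ z, z ≠ 0 → |f z| < |f E| + 1 → g x ≤ |g z| := by
    have hmin : ∀ z, z ≠ 0 → |f z| < |f E| + 1 → |g x₁| ≤ |g z| := by
      intro z hz hfz
      by_cases h : |g z| ≤ |g E|
      · exact hmin₁ z ⟨hz, hfz, h⟩
      · exact hx₁.2.2.trans (not_le.1 h).le
    rcases (show g x₁ ≠ 0 from fun h => hx₁.1 (hfg.eq_zero_right _ h)).lt_or_gt with h | h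
    · refine ⟨-x₁, neg_ne_zero.2 hx₁.1, by simpa using hx₁.2.1, by simpa using h, ?_⟩
      intro z hz hfz
      rw [map_neg, ← abs_of_neg h]
      exact hmin z hz hfz
    · refine ⟨x₁, hx₁.1, hx₁.2.1, h, ?_⟩
      intro z hz hfz
      rw [← abs_of_pos h]
      exact hmin z hz hfz
  have hfx0 : f x ≠ 0 := fun h => hx0 (hfg.eq_zero_left _ h)
  obtain ⟨y₀, hy₀⟩ : ∃ y, det2 x y = 1 := by
    obtain ⟨m, w, hm, hxw, hw⟩ := exists_eq_smul_isCoprime hx0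
    have hmR : (1 : ℝ) ≤ m := by exact_mod_cast hm
    have hw0 : w ≠ 0 := by
      rintro rfl
      exact hx0 (by simpa using hxw)
    have hfw : |f w| ≤ |f x| := by
      rw [hxw, map_zsmul_real, abs_mul, abs_of_pos (by linarith : (0 : ℝ) < m)]
      exact le_mul_of_one_le_left (abs_nonneg _) hmR
    have h1 := hmin w hw0 (hfw.trans_lt hfx)
    have hgw : 0 < g w := by
      rw [hxw, map_zsmul_real] at hgx
      exact pos_of_mul_pos_right hgx (by linarith)
    rw [abs_of_pos hgw, hxw, map_zsmul_real] at h1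
    have h2 : (m : ℝ) ≤ 1 := by
      by_contra! h
      nlinarith
    have h3 : m = 1 := le_antisymm (by exact_mod_cast h2) hm
    rw [h3, one_smul] at hxw
    rw [hxw]
    exact exists_det2_eq_one hw
  have hred : ∀ y, (det2 x y = 1 ∨ det2 x y = -1) → f y / f x < 0 → -1 < f y / f x → 0 < g y →
      IsReduced f g x y := by
    intro y hd h1 h2 hgy
    have hy0 : y ≠ 0 := by rintro rfl; simp at hgy
    have habs : |f y| < |f x| := by
      have h3 : |f y / f x| < 1 := by
        rw [abs_lt]
        exact ⟨h2, h1.trans one_pos⟩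
      rwa [abs_div, div_lt_one (abs_pos.2 hfx0)] at h3
    have hle := hmin y hy0 (habs.trans hfx)
    rw [abs_of_pos hgy] at hle
    refine ⟨hd, h1, h2, hgx, lt_of_le_of_ne hle fun h => ?_⟩
    have : x = y := sub_eq_zero.1 (hfg.eq_zero_right _ (by rw [map_sub, h, sub_self]))
    subst this
    simp at hd
  set r := f y₀ / f x with hr
  set y := y₀ - (⌊r⌋ + 1) • x with hy
  have hdy : det2 x y = 1 := by
    rw [hy, det2_sub_right, det2_smul_right, det2_self, hy₀]; ring
  have hfy : f y / f x = r - ⌊r⌋ - 1 := by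
    rw [hy, map_sub, map_zsmul_real, hr]
    push_cast
    field_simp
    ring
  have h1 : f y / f x < 0 := by
    rw [hfy]
    linarith [Int.lt_floor_add_one r]
  have h2 : -1 < f y / f x := by
    refine lt_of_le_of_ne ?_ fun h => ?_
    · rw [hfy]
      linarith [Int.floor_le r]
    · have h3 : f (y + x) = 0 := by
        rw [map_add]
        field_simp at h
        linarith
      have h4 := hfg.eq_zero_left _ h3
      have h5 : det2 x (y + x) = 1 := by rw [det2_add_right, hdy, det2_self, add_zero]
      rw [h4, det2_comm, det2_zero_left] at h5
      omega
  by_cases hgy : 0 < g y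
  · exact ⟨x, y, hred y (Or.inl hdy) h1 h2 hgy⟩
  -- otherwise the other completion of `x` to a basis with `f` in the same range does it
  · have hy0 : y ≠ 0 := by
      intro h
      rw [h, det2_comm, det2_zero_left] at hdy
      omega
    have habs : |f y| < |f x| := by
      have h3 : |f y / f x| < 1 := by
        rw [abs_lt]
        exact ⟨h2, h1.trans one_pos⟩
      rwa [abs_div, div_lt_one (abs_pos.2 hfx0)] at h3
    have hle := hmin y hy0 (habs.trans hfx)
    rw [abs_of_nonpos (not_lt.1 hgy)] at hle
    have hlt : g x < -g y := lt_of_le_of_ne hle fun h => by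
      have : x + y = 0 := hfg.eq_zero_right _ (by rw [map_add, h]; ring)
      have h5 : det2 x (x + y) = 1 := by rw [det2_add_right, hdy, det2_self, zero_add]
      rw [this, det2_comm, det2_zero_left] at h5
      omega
    have hdiv : f (-y - x) / f x = -(f y / f x) - 1 := by
      rw [map_sub, map_neg]
      field_simp
    refine ⟨x, -y - x, hred _ (Or.inr ?_) ?_ ?_ ?_⟩
    · rw [det2_sub_right, det2_neg_right, hdy, det2_self]; ring
    · rw [hdiv]; linarith
    · rw [hdiv]; linarith
    · rw [map_sub, map_neg]; linarith

end

/-- A reduced basis extends to a two-sided chain of reduced bases. -/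
theorem IsIrrationalFrame.exists_chain_through {f g : IntPt →+ ℝ} {c : ℝ}
    (hfg : IsIrrationalFrame f g c) {x y : IntPt} (h : IsReduced f g x y) :
    ∃ v : ℤ → IntPt, v 0 = x ∧ v 1 = y ∧ ∀ j, IsReduced f g (v j) (v (j + 1)) := by
  let R := {p : IntPt × IntPt // IsReduced f g p.1 p.2}
  have hnext : ∀ p : R, ∃ q : R, q.1.1 = p.1.2 := fun p => by
    obtain ⟨a, z, -, -, hz⟩ := p.2.exists_next hfg
    exact ⟨⟨(p.1.2, z), hz⟩, rfl⟩
  have hprev : ∀ p : R, ∃ q : R, q.1.2 = p.1.1 := fun p => by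
    obtain ⟨z, hz⟩ := p.2.exists_prev hfg
    exact ⟨⟨(z, p.1.1), hz⟩, rfl⟩
  choose S hS using hnext
  choose P hP using hprev
  have hext1 : ∀ p q : R, p.1.1 = q.1.1 → p = q := by
    rintro ⟨⟨a, b⟩, hp⟩ ⟨⟨a', b'⟩, hq⟩ (h : a = a')
    subst h
    have h2 : b = b' := IsReduced.right_unique hfg hp hq
    subst h2
    rfl
  have hext2 : ∀ p q : R, p.1.2 = q.1.2 → p = q := by
    rintro ⟨⟨a, b⟩, hp⟩ ⟨⟨a', b'⟩, hq⟩ (h : b = b')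
    subst h
    have h2 : a = a' := IsReduced.left_unique hfg hp hq
    subst h2
    rfl
  let T : Equiv.Perm R :=
    { toFun := S
      invFun := P
      left_inv := fun p => hext2 _ _ (by rw [hP, hS])
      right_inv := fun p => hext1 _ _ (by rw [hS, hP]) }
  have hT : ∀ j : ℤ, ((T ^ (j + 1)) ⟨(x, y), h⟩).1.1 = ((T ^ j) ⟨(x, y), h⟩).1.2 := by
    intro j
    rw [add_comm, zpow_add, zpow_one]
    exact hS _
  refine ⟨fun j => ((T ^ j) ⟨(x, y), h⟩).1.1, by simp, ?_, fun j => ?_⟩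
  · have := hT 0
    simpa using this
  · show IsReduced f g ((T ^ j) ⟨(x, y), h⟩).1.1 ((T ^ (j + 1)) ⟨(x, y), h⟩).1.1
    rw [hT]
    exact ((T ^ j) ⟨(x, y), h⟩).2

section

variable {f g : IntPt →+ ℝ} {c : ℝ}

/-- Two chains of reduced bases with a common vector coincide. -/
theorem IsIrrationalFrame.chain_unique (hfg : IsIrrationalFrame f g c) {v w : ℤ → IntPt}
    (hv : ∀ j, IsReduced f g (v j) (v (j + 1))) (hw : ∀ j, IsReduced f g (w j) (w (j + 1)))
    (h0 : v 0 = w 0) : v = w := by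
  funext j
  induction j using Int.induction_on with
  | zero => exact h0
  | succ j ih =>
    have h1 := hv j
    rw [ih] at h1
    exact h1.right_unique hfg (hw j)
  | pred j ih =>
    have h1 := hv (-j - 1)
    have h2 := hw (-j - 1)
    rw [sub_add_cancel, ih] at h1
    rw [sub_add_cancel] at h2
    exact h1.left_unique hfg h2

/-- A reduced basis starts on every chain that it lies ahead of: comparing boxes, its first vector
is the last `v n` with `g (v n) ≤ g x`. -/
theorem IsIrrationalFrame.exists_eq_chain (hfg : IsIrrationalFrame f g c) {v : ℤ → IntPt}
    (hv : ∀ j, IsReduced f g (v j) (v (j + 1))) {x y : IntPt} (h : IsReduced f g x y)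
    (hx : g (v 0) < g x) : ∃ n : ℕ, 0 < n ∧ x = v n := by
  have hgrow : ∀ n : ℕ, n * g (v 0) ≤ g (v (n + 1)) ∧ g (v 0) ≤ g (v n) := by
    intro n
    induction n with
    | zero => simpa using ((hv 0).pos.trans (hv 0).lt).le
    | succ n ih =>
      obtain ⟨a, z, ha, hz, hr⟩ := (hv n).exists_next hfg
      have e : v ((n + 1 : ℕ) + 1) = z := by
        push_cast
        exact (hv _).right_unique hfg hr
      have haR : (1 : ℝ) ≤ (a : ℤ) := by exact_mod_cast ha
      rw [e, hz, map_add, map_zsmul_real]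
      push_cast at haR ⊢
      have hp := (hv ((n : ℤ) + 1)).pos
      constructor
      · nlinarith [ih.1, ih.2]
      · exact ih.2.trans (hv n).lt.le
  have hex : ∃ n : ℕ, g x < g (v (n + 1)) := by
    obtain ⟨n, hn⟩ := exists_nat_gt (g x / g (v 0))
    rw [div_lt_iff₀ (hv 0).pos] at hn
    exact ⟨n, hn.trans_le (hgrow n).1⟩
  classical
  obtain ⟨j, hj, hmin⟩ : ∃ j : ℕ, g x < g (v (j + 1)) ∧ g (v j) ≤ g x := by
    refine ⟨Nat.find hex, Nat.find_spec hex, ?_⟩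
    rcases hfd : Nat.find hex with _ | m
    · simpa using hx.le
    · have := Nat.find_min hex (m := m) (by omega)
      push_cast
      exact not_lt.1 this
  have hxj : x = v j := by
    have hx0 : x ≠ 0 := by rintro rfl; simpa using h.pos
    have hv0 : v j ≠ 0 := by
      intro h0
      have := (hv j).pos
      simp [h0] at this
    refine hfg.eq_of_abs_eq h.pos (hv j).pos (le_antisymm ?_ ?_)
    · rcases h.box hv0 with h1 | h1
      · exact h1
      · rw [abs_of_pos (hv j).pos] at h1
        linarith [h.lt]
    · rcases (hv j).box hx0 with h1 | h1
      · exact h1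
      · rw [abs_of_pos h.pos] at h1
        linarith
  refine ⟨j, Nat.pos_of_ne_zero ?_, hxj⟩
  rintro rfl
  rw [hxj] at hx
  simp at hx

end

/-- The action of an integer matrix on the lattice. -/
abbrev act (M : Matrix (Fin 2) (Fin 2) ℤ) (x : IntPt) : IntPt := M.mulVec x

theorem det2_act (M : Matrix (Fin 2) (Fin 2) ℤ) (x y : IntPt) :
    det2 (act M x) (act M y) = M.det * det2 x y := by
  simp only [act, det2, Matrix.mulVec, dotProduct, Fin.sum_univ_two, Matrix.det_fin_two]
  ring

/-- The chain of lattice vectors of a two-sided continued fraction with partial quotients `a`: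
the vectors with even index are the vertices of one sail and the vectors with odd index those
of the sail of an adjacent cone, while each vector is also the direction of an edge of the
other sail. -/
structure IsBichain (f g : IntPt →+ ℝ) (σ : ℤ) (v : ℤ → IntPt) (a : ℤ → ℕ) : Prop where
  pos : ∀ j, 0 < a j
  step : ∀ j, v (j + 2) = v j + (a j : ℤ) • v (j + 1)
  det_even : ∀ k, σ * det2 (v (2 * k)) (v (2 * k + 1)) = 1
  f_even : ∀ k, 0 < f (v (2 * k))
  f_odd : ∀ k, f (v (2 * k + 1)) < 0
  g_pos : ∀ j, 0 < g (v j)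

theorem IsBichain.det_odd {f g : IntPt →+ ℝ} {σ : ℤ} {v : ℤ → IntPt} {a : ℤ → ℕ}
    (h : IsBichain f g σ v a) (k : ℤ) :
    -σ * det2 (v (2 * k + 1)) (v (2 * k + 2)) = 1 := by
  refine Eq.trans ?_ (h.det_even k)
  rw [h.step, det2_add_right, det2_smul_right, det2_self, det2_comm]
  ring

/-- Advancing by one exchanges the two sails. -/
theorem IsBichain.succ {f g : IntPt →+ ℝ} {σ : ℤ} {v : ℤ → IntPt} {a : ℤ → ℕ}
    (h : IsBichain f g σ v a) :
    IsBichain (-f) g (-σ) (fun j => v (j + 1)) (fun j => a (j + 1)) where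
  pos j := h.pos _
  step j := by
    have := h.step (j + 1)
    rw [← this]
    congr 1
    ring
  det_even k := by
    rw [add_assoc]
    exact h.det_odd k
  f_even k := by simpa using h.f_odd k
  f_odd k := by
    have := h.f_even (k + 1)
    have e : 2 * k + 1 + 1 = 2 * (k + 1) := by ring
    simpa [e] using this
  g_pos j := h.g_pos _

theorem IsBichain.neg {f g : IntPt →+ ℝ} {σ : ℤ} {v : ℤ → IntPt} {a : ℤ → ℕ}
    (h : IsBichain f g σ v a) : IsBichain (-f) (-g) σ (fun j => -v j) a where
  pos j := h.pos _
  step j := by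
    rw [h.step, smul_neg]
    abel
  det_even k := by
    rw [det2_neg_left, det2_neg_right, neg_neg, h.det_even]
  f_even k := by simpa using h.f_even k
  f_odd k := by simpa using h.f_odd k
  g_pos j := by simpa using h.g_pos j

theorem IsBichain.shift {f g : IntPt →+ ℝ} {σ : ℤ} {v : ℤ → IntPt} {a : ℤ → ℕ}
    (h : IsBichain f g σ v a) (i : ℤ) :
    IsBichain f g σ (fun j => v (j + 2 * i)) (fun j => a (j + 2 * i)) where
  pos j := h.pos _
  step j := by
    have := h.step (j + 2 * i)
    rw [show j + 1 + 2 * i = j + 2 * i + 1 by ring, ← this]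
    congr 1
    ring
  det_even k := by
    have := h.det_even (k + i)
    rw [show 2 * k + 1 + 2 * i = 2 * (k + i) + 1 by ring,
      show 2 * k + 2 * i = 2 * (k + i) by ring, this]
  f_even k := by
    rw [show 2 * k + 2 * i = 2 * (k + i) by ring]
    exact h.f_even _
  f_odd k := by
    rw [show 2 * k + 1 + 2 * i = 2 * (k + i) + 1 by ring]
    exact h.f_odd _
  g_pos j := h.g_pos _

/-- The two-sided continued fraction of a hyperbolic matrix: the matrix shifts it. -/
theorem exists_isBichain {f g : IntPt →+ ℝ} {c α β : ℝ} {M : Matrix (Fin 2) (Fin 2) ℤ}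
    (hfg : IsIrrationalFrame f g c) (hf : ∀ x, f (act M x) = β * f x)
    (hg : ∀ x, g (act M x) = α * g x) (hα : 1 < α) (hβ : β ≠ 0)
    (hdet : M.det = 1 ∨ M.det = -1) :
    ∃ (n : ℕ) (σ : ℤ) (v : ℤ → IntPt) (a : ℤ → ℕ), 0 < n ∧ IsBichain f g σ v a ∧
      ∀ j, act M (v j) = v (j + n) := by
  have hMred : ∀ {x y}, IsReduced f g x y → IsReduced f g (act M x) (act M y) := by
    intro x y h
    have hq : f (act M y) / f (act M x) = f y / f x := by
      rw [hf, hf, mul_div_mul_left _ _ hβ]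
    refine ⟨?_, by rw [hq]; exact h.neg, by rw [hq]; exact h.gt, ?_, ?_⟩
    · rw [det2_act]
      rcases hdet with h1 | h1 <;> rcases h.det with h2 | h2 <;> simp [h1, h2]
    · rw [hg]
      exact mul_pos (by linarith) h.pos
    · rw [hg, hg]
      exact mul_lt_mul_of_pos_left h.lt (by linarith)
  obtain ⟨x, y, hxy⟩ : ∃ x y, IsReduced f g x y ∧ 0 < f x := by
    obtain ⟨x, y, h⟩ := hfg.exists_isReduced
    obtain ⟨a, z, -, -, hz⟩ := h.exists_next hfg
    rcases h.f_ne_zero.lt_or_gt with h0 | h0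
    · exact ⟨y, z, hz, pos_of_mul_neg_left h.mul_lt_zero h0.le⟩
    · exact ⟨x, y, h, h0⟩
  obtain ⟨v, rfl, rfl, hv⟩ := hfg.exists_chain_through hxy.1
  have hMv : ∀ j, IsReduced f g (act M (v j)) (act M (v (j + 1))) := fun j => hMred (hv j)
  obtain ⟨n, hn, hvn⟩ := hfg.exists_eq_chain hv (hMv 0) (by
    rw [hg]
    have := (hv 0).pos
    nlinarith)
  have hshift : (fun j => act M (v j)) = fun j => v (j + n) := by
    refine hfg.chain_unique hMv (fun j => ?_) (by simpa using hvn)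
    rw [show j + 1 + (n : ℤ) = j + n + 1 by ring]
    exact hv _
  have hstep : ∀ j, ∃ a : ℕ, 0 < a ∧ v (j + 2) = v j + (a : ℤ) • v (j + 1) := by
    intro j
    obtain ⟨a, z, ha, hz, hr⟩ := (hv j).exists_next hfg
    refine ⟨a, ha, ?_⟩
    rw [← hz]
    have := hv (j + 1)
    rw [show j + 1 + 1 = j + 2 by ring] at this
    exact this.right_unique hfg hr
  choose a ha hstep using hstep
  have heven : ∀ k : ℤ, 0 < f (v (2 * k)) := by
    intro k
    induction k using Int.induction_on with
    | zero => exact hxy.2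
    | succ k ih =>
      have h1 := (hv (2 * k)).mul_lt_zero
      have h2 := (hv (2 * k + 1)).mul_lt_zero
      rw [show 2 * ((k : ℤ) + 1) = 2 * k + 1 + 1 by ring]
      exact pos_of_mul_neg_left h2 (neg_of_mul_neg_left h1 ih.le).le
    | pred k ih =>
      have h1 := (hv (2 * (-k - 1))).mul_lt_zero
      have h2 := (hv (2 * (-k - 1) + 1)).mul_lt_zero
      rw [show 2 * (-(k : ℤ) - 1) + 1 + 1 = 2 * -k by ring] at h2
      exact pos_of_mul_neg_right h1 (neg_of_mul_neg_right h2 ih.le).le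
  have hdet0 : ∀ k : ℤ, det2 (v (2 * k)) (v (2 * k + 1)) = det2 (v 0) (v 1) := by
    have hone : ∀ k : ℤ, det2 (v (2 * (k + 1))) (v (2 * (k + 1) + 1)) =
        det2 (v (2 * k)) (v (2 * k + 1)) := by
      intro k
      rw [show 2 * (k + 1) + 1 = 2 * k + 1 + 2 by ring, hstep,
        show 2 * k + 1 + 1 = 2 * (k + 1) by ring, det2_add_right, det2_smul_right, det2_self,
        show 2 * (k + 1) = 2 * k + 2 by ring, hstep, det2_add_left, det2_smul_left, det2_self]
      ring
    intro k
    induction k using Int.induction_on with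
    | zero => simp
    | succ k ih => rw [hone, ih]
    | pred k ih => rw [← hone, sub_add_cancel, ih]
  refine ⟨n, det2 (v 0) (v 1), v, a, hn, ⟨ha, hstep, fun k => ?_, heven, fun k => ?_,
    fun j => (hv j).pos⟩, fun j => congrFun hshift j⟩
  · rw [hdet0]
    have := (hv 0).det
    rw [zero_add] at this
    rcases this with h | h <;> simp [h]
  · exact neg_of_mul_neg_left (hv (2 * k)).mul_lt_zero (heven k).le

/-! ### Locally convex chains and their sails -/

/-- The points `A m, …, A n` form a locally convex lattice chain with edge directions `e k`:
each `(A k, e k)` is a lattice basis of orientation `σ`, and the chain turns at each inner vertex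
away from the origin. -/
structure IsChain (σ : ℤ) (A e : ℤ → IntPt) (m n : ℤ) : Prop where
  det : ∀ k, m ≤ k → k < n → σ * det2 (A k) (e k) = 1
  edge : ∀ k, m ≤ k → k < n → ∃ a : ℤ, 0 < a ∧ A (k + 1) = A k + a • e k
  vertex : ∀ k, m < k → k < n → ∃ b : ℤ, 0 < b ∧ e k = e (k - 1) + b • A k

/-- Along a broken line seen from the origin, `det (A k, x)` decreases as long as `x` lies beyond
the edges. -/
theorem mul_det2_lt {σ : ℤ} {A e : ℤ → IntPt} {x : IntPt} {k l : ℤ} (hkl : k < l)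
    (h : ∀ j, k ≤ j → j < l →
      (∃ a : ℤ, 0 < a ∧ A (j + 1) = A j + a • e j) ∧ 0 < σ * det2 x (e j)) :
    σ * det2 (A l) x < σ * det2 (A k) x := by
  have step : ∀ j, k ≤ j → j < l → σ * det2 (A (j + 1)) x < σ * det2 (A j) x := by
    intro j h1 h2
    obtain ⟨⟨a, ha, hA⟩, hx⟩ := h j h1 h2
    rw [hA, det2_add_left, det2_smul_left, det2_comm (e j)]
    nlinarith
  have aux : ∀ j, k + 1 ≤ j → j ≤ l → σ * det2 (A j) x < σ * det2 (A k) x := by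
    intro j hj
    induction j, hj using Int.leInduction with
    | base => exact fun hl => step k le_rfl (by omega)
    | succ j hj ih => exact fun hl => (step j (by omega) (by omega)).trans (ih (by omega))
  exact aux l (by omega) le_rfl

theorem injOn_of_edges {C : Set RealPt} {σ : ℤ} {A e : ℤ → IntPt} {I : Set ℤ}
    (hI : I.OrdConnected) (hmem : ∀ k ∈ I, toReal (A k) ∈ C) (hne : ∀ k ∈ I, A k ≠ 0)
    (hedge : ∀ k ∈ I, k + 1 ∈ I → (∃ a : ℤ, 0 < a ∧ A (k + 1) = A k + a • e k) ∧
      ∀ x, toReal x ∈ C → x ≠ 0 → 0 < σ * det2 x (e k)) : Set.InjOn A I := by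
  have key : ∀ k ∈ I, ∀ l ∈ I, k < l → A k ≠ A l := by
    intro k hk l hl hkl heq
    have h := mul_det2_lt (σ := σ) (x := A k) (A := A) (e := e) hkl fun j h1 h2 => by
      have hj : j ∈ I := hI.out hk hl ⟨h1, h2.le⟩
      have hj1 : j + 1 ∈ I := hI.out hk hl ⟨by omega, by omega⟩
      exact ⟨(hedge j hj hj1).1, (hedge j hj hj1).2 _ (hmem k hk) (hne k hk)⟩
    rw [← heq] at h
    exact lt_irrefl _ h
  intro k hk l hl h
  rcases lt_trichotomy k l with h1 | h1 | h1
  · exact absurd h (key k hk l hl h1)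
  · exact h1
  · exact absurd h.symm (key l hl k hk h1)

section

variable {σ : ℤ} {A e : ℤ → IntPt} {m n : ℤ}

theorem IsChain.forward (h : IsChain σ A e m n) {k : ℤ} (hk : m ≤ k) (hkn : k < n) :
    0 ≤ σ * det2 (A m) (A k) ∧ 0 < σ * det2 (A m) (e k) := by
  induction k, hk using Int.leInduction with
  | base => simp [h.det m le_rfl hkn]
  | succ k hk ih =>
    obtain ⟨h1, h2⟩ := ih (by omega)
    obtain ⟨a, ha, hA⟩ := h.edge k hk (by omega)
    obtain ⟨b, hb, he⟩ := h.vertex (k + 1) (by omega) hkn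
    rw [add_sub_cancel_right] at he
    have h3 : 0 ≤ σ * det2 (A m) (A (k + 1)) := by
      rw [hA, det2_add_right, det2_smul_right]
      nlinarith
    refine ⟨h3, ?_⟩
    rw [he, det2_add_right, det2_smul_right]
    nlinarith

theorem IsChain.forward_vertex (h : IsChain σ A e m n) {k : ℤ} (hk : m ≤ k) (hkn : k ≤ n) :
    0 ≤ σ * det2 (A m) (A k) := by
  rcases hk.eq_or_lt with rfl | hk
  · simp
  · obtain ⟨h1, h2⟩ := h.forward (k := k - 1) (by omega) (by omega)
    obtain ⟨a, ha, hA⟩ := h.edge (k - 1) (by omega) (by omega)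
    rw [sub_add_cancel] at hA
    rw [hA, det2_add_right, det2_smul_right]
    nlinarith

theorem IsChain.det_succ (h : IsChain σ A e m n) {k : ℤ} (hk : m ≤ k) (hkn : k < n) :
    σ * det2 (A (k + 1)) (e k) = 1 := by
  obtain ⟨a, ha, hA⟩ := h.edge k hk hkn
  rw [hA, det2_add_left, det2_smul_left, det2_self, mul_zero, add_zero, h.det k hk hkn]

theorem IsChain.backward (h : IsChain σ A e m n) {k : ℤ} (hkn : k ≤ n - 1) (hk : m ≤ k) :
    0 ≤ σ * det2 (A (k + 1)) (A n) ∧ 0 < σ * det2 (A n) (e k) := by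
  induction k, hkn using Int.leInductionDown with
  | base =>
    rw [sub_add_cancel]
    have := h.det_succ (k := n - 1) hk (by omega)
    rw [sub_add_cancel] at this
    simp [this]
  | pred k hkn ih =>
    obtain ⟨h1, h2⟩ := ih (by omega)
    obtain ⟨a, ha, hA⟩ := h.edge k (by omega) (by omega)
    obtain ⟨b, hb, he⟩ := h.vertex k (by omega) (by omega)
    rw [sub_add_cancel]
    have h3 : 0 ≤ σ * det2 (A k) (A n) := by
      have : A k = A (k + 1) - a • e k := by rw [hA, add_sub_cancel_right]
      rw [this, det2_sub_left, det2_smul_left, det2_comm (e k)]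
      nlinarith
    refine ⟨h3, ?_⟩
    have : e (k - 1) = e k - b • A k := by rw [he, add_sub_cancel_right]
    rw [this, det2_sub_right, det2_smul_right, det2_comm (A n) (A k)]
    nlinarith

theorem IsChain.backward_vertex (h : IsChain σ A e m n) {k : ℤ} (hk : m ≤ k) (hkn : k ≤ n) :
    0 ≤ σ * det2 (A k) (A n) := by
  rcases hkn.eq_or_lt with rfl | hkn
  · simp
  · obtain ⟨h1, h2⟩ := h.backward (k := k) (by omega) hk
    obtain ⟨a, ha, hA⟩ := h.edge k hk hkn
    have : A k = A (k + 1) - a • e k := by rw [hA, add_sub_cancel_right]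
    rw [this, det2_sub_left, det2_smul_left, det2_comm (e k)]
    nlinarith

theorem IsChain.det_pos (h : IsChain σ A e m n) (hmn : m < n) : 0 < σ * det2 (A m) (A n) := by
  obtain ⟨h1, h2⟩ := h.forward (k := n - 1) (by omega) (by omega)
  obtain ⟨a, ha, hA⟩ := h.edge (n - 1) (by omega) (by omega)
  rw [sub_add_cancel] at hA
  rw [hA, det2_add_right, det2_smul_right]
  nlinarith

/-- The vertices of a chain are nonnegative combinations of its end points. -/
theorem IsChain.map_nonneg (h : IsChain σ A e m n) (f : IntPt →+ ℝ) (hm : 0 ≤ f (A m))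
    (hn : 0 ≤ f (A n)) {k : ℤ} (hk : m ≤ k) (hkn : k ≤ n) : 0 ≤ f (A k) := by
  rcases (hk.trans hkn).eq_or_lt with rfl | hmn
  · rwa [le_antisymm hkn hk]
  have hD : (0 : ℝ) < σ * det2 (A m) (A n) := by exact_mod_cast h.det_pos hmn
  have h1 : (0 : ℝ) ≤ σ * det2 (A m) (A k) := by exact_mod_cast h.forward_vertex hk hkn
  have h2 : (0 : ℝ) ≤ σ * det2 (A k) (A n) := by exact_mod_cast h.backward_vertex hk hkn
  have hcr := congrArg f (det2_smul_eq (A m) (A n) (A k))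
  simp only [map_add, map_zsmul_real] at hcr
  have h3 : (σ * det2 (A m) (A n)) * f (A k) =
      σ * det2 (A k) (A n) * f (A m) + σ * det2 (A m) (A k) * f (A n) := by
    linear_combination (σ : ℝ) * hcr
  have h4 : 0 ≤ (σ * det2 (A m) (A n)) * f (A k) := by
    rw [h3]
    positivity
  exact nonneg_of_mul_nonneg_right h4 hD

theorem angle_two_smul {u v : RealPt} {x : IntPt} (h : toReal x ∈ angle u v) :
    toReal ((2 : ℤ) • x) ∈ angle u v := by
  obtain ⟨s, t, hs, ht, hx⟩ := h
  refine ⟨2 * s, 2 * t, by positivity, by positivity, ?_⟩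
  rw [toReal_zsmul, hx, smul_add, smul_smul, smul_smul]
  push_cast
  rfl

/-- A chain is the sail of the angle spanned by its end points. -/
theorem IsChain.isSailLine (h : IsChain σ A e m n) (hmn : m < n) {P Q : IntPt} {p q : ℤ}
    (hp : 0 < p) (hq : 0 < q) (hP : P = p • A m) (hQ : Q = q • A n) :
    IsSailLine (angle (toReal P) (toReal Q)) (Set.Icc m n) A := by
  have hσ : σ ≠ 0 := by
    rintro rfl
    simpa using h.det m le_rfl hmn
  have hpR : (0 : ℝ) < p := by exact_mod_cast hp
  have hqR : (0 : ℝ) < q := by exact_mod_cast hq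
  have hDR : (0 : ℝ) < σ * det2 (A m) (A n) := by exact_mod_cast h.det_pos hmn
  have hcomb : ∀ x : IntPt, toReal x ∈ angle (toReal P) (toReal Q) → x ≠ 0 →
      ∃ s t : ℝ, 0 ≤ s ∧ 0 ≤ t ∧ 0 < s + t ∧
        ∀ d, (det2 x d : ℝ) = s * det2 (A m) d + t * det2 (A n) d := by
    rintro x ⟨s, t, hs, ht, hx⟩ hx0
    refine ⟨s * p, t * q, by positivity, by positivity, ?_, fun d => ?_⟩
    · rcases hs.eq_or_lt with rfl | hs
      · rcases ht.eq_or_lt with rfl | ht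
        · exact absurd (toReal_eq_zero.1 (by simpa using hx)) hx0
        · positivity
      · positivity
    · have := congrArg (detWith d) hx
      rw [map_add, map_smul, map_smul, detWith_toReal, detWith_toReal, detWith_toReal, hP, hQ,
        det2_smul_left, det2_smul_left] at this
      rw [this]
      push_cast
      simp only [smul_eq_mul]
      ring
  have hxe : ∀ k, m ≤ k → k < n → ∀ x, toReal x ∈ angle (toReal P) (toReal Q) → x ≠ 0 →
      0 < σ * det2 x (e k) := by
    intro k hk hkn x hx hx0
    obtain ⟨s, t, hs, ht, hst, hd⟩ := hcomb x hx hx0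
    have h1 : (1 : ℝ) ≤ σ * det2 (A m) (e k) := by exact_mod_cast (h.forward hk hkn).2
    have h2 : (1 : ℝ) ≤ σ * det2 (A n) (e k) := by
      exact_mod_cast (h.backward (by omega) hk).2
    have h3 : (0 : ℝ) < σ * det2 x (e k) := by
      rw [hd]
      nlinarith
    exact_mod_cast h3
  have hxm : ∀ x, toReal x ∈ angle (toReal P) (toReal Q) → x ≠ 0 → 0 ≤ σ * det2 (A m) x := by
    intro x hx hx0
    obtain ⟨s, t, hs, ht, hst, hd⟩ := hcomb x hx hx0
    have h3 : (0 : ℝ) ≤ σ * det2 (A m) x := by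
      rw [det2_comm, Int.cast_neg, hd, det2_self, det2_comm (A n)]
      push_cast
      nlinarith
    exact_mod_cast h3
  have hxn : ∀ x, toReal x ∈ angle (toReal P) (toReal Q) → x ≠ 0 → 0 ≤ σ * det2 x (A n) := by
    intro x hx hx0
    obtain ⟨s, t, hs, ht, hst, hd⟩ := hcomb x hx hx0
    have h3 : (0 : ℝ) ≤ σ * det2 x (A n) := by
      rw [hd, det2_self]
      push_cast
      nlinarith
    exact_mod_cast h3
  have hmem : ∀ k ∈ Set.Icc m n, toReal (A k) ∈ angle (toReal P) (toReal Q) := by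
    rintro k ⟨hk, hkn⟩
    have h1 : (0 : ℝ) ≤ σ * det2 (A m) (A k) := by exact_mod_cast h.forward_vertex hk hkn
    have h2 : (0 : ℝ) ≤ σ * det2 (A k) (A n) := by exact_mod_cast h.backward_vertex hk hkn
    refine ⟨σ * det2 (A k) (A n) / (σ * det2 (A m) (A n)) / p,
      σ * det2 (A m) (A k) / (σ * det2 (A m) (A n)) / q, by positivity, by positivity, ?_⟩
    rw [hP, hQ, toReal_zsmul, toReal_zsmul, smul_smul, smul_smul]
    have hcr := det2_smul_eq (A m) (A n) (A k)
    have hd0 := right_ne_zero_of_mul hDR.ne'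
    have hs0 := left_ne_zero_of_mul hDR.ne'
    ext i
    have := congrFun hcr i
    simp only [Pi.add_apply, Pi.smul_apply, smul_eq_mul] at this
    have hR : (det2 (A m) (A n) : ℝ) * A k i =
      det2 (A k) (A n) * A m i + det2 (A m) (A k) * A n i := by exact_mod_cast this
    simp only [Pi.add_apply, Pi.smul_apply, smul_eq_mul, toReal_apply]
    field_simp
    linarith
  have hne : ∀ k ∈ Set.Icc m n, A k ≠ 0 := by
    rintro k ⟨hk, hkn⟩ h0
    rcases hkn.eq_or_lt with rfl | hkn
    · have := h.det_succ (k := k - 1) (by omega) (by omega)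
      rw [sub_add_cancel, h0] at this
      simp at this
    · have := h.det k hk hkn
      rw [h0] at this
      simp at this
  have hedge : ∀ k, m ≤ k → k < n → ∃ a : ℤ, 0 < a ∧ A (k + 1) = A k + a • e k := h.edge
  have hchoice : ∀ k, ∃ a : ℤ, m ≤ k → k < n → 0 < a ∧ A (k + 1) = A k + a • e k := by
    intro k
    by_cases hk : m ≤ k ∧ k < n
    · obtain ⟨a, ha⟩ := hedge k hk.1 hk.2
      exact ⟨a, fun _ _ => ha⟩
    · exact ⟨0, fun h1 h2 => absurd ⟨h1, h2⟩ hk⟩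
  choose a ha using hchoice
  refine isSailLine_of_supported (e := e) (a := a) (σ := σ) hmem hne (fun x => angle_two_smul)
    ?_ ?_ ?_ ?_ hσ
  · refine injOn_of_edges (σ := σ) (e := e) Set.ordConnected_Icc hmem hne ?_
    rintro k ⟨hk, -⟩ ⟨-, hkn⟩
    exact ⟨hedge k hk (by omega), hxe k hk (by omega)⟩
  · rintro k ⟨hk, -⟩ ⟨-, hkn⟩
    have hkn' : k < n := by omega
    exact ⟨(ha k hk hkn').1, h.det k hk hkn', (ha k hk hkn').2, hxe k hk hkn'⟩
  · rintro k ⟨hk, hkn⟩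
    rcases hk.eq_or_lt with rfl | hk
    · refine ⟨e m, -A m, ?_, fun x hx hx0 => ⟨?_, ?_⟩⟩
      · rw [det2_neg_right, ← det2_comm]
        exact right_ne_zero_of_mul (by rw [h.det m le_rfl hmn]; exact one_ne_zero)
      · rw [h.det m le_rfl hmn]
        exact hxe m le_rfl hmn x hx hx0
      · rw [det2_neg_right, det2_neg_right, det2_self, ← det2_comm]
        simpa using hxm x hx hx0
    · have hd := h.det_succ (k := k - 1) (by omega) (by omega)
      rw [sub_add_cancel] at hd
      rcases hkn.eq_or_lt with rfl | hkn
      · refine ⟨e (k - 1), A k, ?_, fun x hx hx0 => ⟨?_, ?_⟩⟩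
        · rw [det2_comm, neg_ne_zero]
          exact right_ne_zero_of_mul (by rw [hd]; exact one_ne_zero)
        · rw [hd]
          exact hxe (k - 1) (by omega) (by omega) x hx hx0
        · rw [det2_self, mul_zero]
          exact hxn x hx hx0
      · obtain ⟨b, hb, he⟩ := h.vertex k hk hkn
        refine ⟨e (k - 1), e k, ?_, fun x hx hx0 => ⟨?_, ?_⟩⟩
        · rw [he, det2_add_right, det2_self, zero_add, det2_smul_right, det2_comm]
          refine mul_ne_zero hb.ne' (neg_ne_zero.2 ?_)
          exact right_ne_zero_of_mul (by rw [hd]; exact one_ne_zero)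
        · rw [hd]
          exact hxe (k - 1) (by omega) (by omega) x hx hx0
        · rw [h.det k hk.le hkn]
          exact hxe k hk.le hkn x hx hx0
  · intro x hx hx0
    -- the last vertex that is not beyond `x`
    obtain ⟨k, ⟨hk, hkn, hkx⟩, hmax⟩ := Int.exists_greatest_of_bdd
      (P := fun k => m ≤ k ∧ k < n ∧ 0 ≤ σ * det2 (A k) x) ⟨n, fun k hk => hk.2.1.le⟩
      ⟨m, le_rfl, hmn, hxm x hx hx0⟩
    refine ⟨k, ⟨hk, hkn.le⟩, ⟨by omega, by omega⟩, hkx, ?_⟩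
    rcases (show k + 1 ≤ n by omega).eq_or_lt with h1 | h1
    · rw [h1]
      exact hxn x hx hx0
    · by_contra! h2
      have := hmax (k + 1) ⟨by omega, h1, by rw [det2_comm]; linarith⟩
      omega

end

/-- An integer sequence that decreases everywhere changes its sign. -/
theorem exists_sign_change {d : ℤ → ℤ} (hd : ∀ k, d (k + 1) < d k) :
    ∃ k, 0 ≤ d k ∧ d (k + 1) < 0 := by
  have hup : ∀ k : ℕ, d k ≤ d 0 - k := by
    intro k
    induction k with
    | zero => simp
    | succ k ih =>
      have := hd k
      push_cast
      omega
  have hdown : ∀ k : ℕ, d 0 + k ≤ d (-k) := by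
    intro k
    induction k with
    | zero => simp
    | succ k ih =>
      have := hd (-(k + 1 : ℕ))
      rw [show (-((k + 1 : ℕ) : ℤ)) + 1 = -k by push_cast; ring] at this
      push_cast at *
      omega
  obtain ⟨k, hk, hmax⟩ := Int.exists_greatest_of_bdd (P := fun k => 0 ≤ d k)
    ⟨max 0 (d 0), fun k hk => by
      by_contra! h
      obtain ⟨l, rfl⟩ := Int.eq_ofNat_of_zero_le ((le_max_left _ _).trans h.le)
      have := hup l
      have := le_max_right 0 (d 0)
      omega⟩
    ⟨-((d 0).natAbs : ℤ), by
      have := hdown (d 0).natAbs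
      omega⟩
  refine ⟨k, hk, ?_⟩
  by_contra! h
  have := hmax (k + 1) h
  omega

section

variable {f g : IntPt →+ ℝ} {c : ℝ} {σ : ℤ} {v : ℤ → IntPt} {a : ℤ → ℕ}

theorem IsBichain.isChain (h : IsBichain f g σ v a) (m n : ℤ) :
    IsChain σ (fun k => v (2 * k)) (fun k => v (2 * k + 1)) m n where
  det k _ _ := h.det_even k
  edge k _ _ := ⟨a (2 * k), by exact_mod_cast h.pos _, by
    rw [← h.step, mul_add, mul_one]⟩
  vertex k _ _ := ⟨a (2 * k - 1), by exact_mod_cast h.pos _, by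
    have := h.step (2 * k - 1)
    rw [sub_add_cancel, show 2 * k - 1 + 2 = 2 * k + 1 by ring] at this
    rw [this]
    congr 2
    ring⟩

/-- The edge directions of a sail lie in the adjacent cone. -/
theorem IsBichain.det2_odd_pos (h : IsBichain f g σ v a) (hfg : IsIrrationalFrame f g c)
    {x : IntPt} (hf : 0 ≤ f x) (hg : 0 ≤ g x) (hx : x ≠ 0) (k : ℤ) :
    0 < σ * det2 x (v (2 * k + 1)) := by
  have hfx : 0 < f x := lt_of_le_of_ne hf fun h0 => hx (hfg.eq_zero_left _ h0.symm)
  have hgx : 0 < g x := lt_of_le_of_ne hg fun h0 => hx (hfg.eq_zero_right _ h0.symm)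
  have h1 : 0 < c * det2 x (v (2 * k + 1)) := by
    rw [← hfg.wedge]
    nlinarith [mul_pos hfx (h.g_pos (2 * k + 1)), mul_pos hgx (neg_pos.2 (h.f_odd k))]
  have h2 : 0 < c * det2 (v (2 * k)) (v (2 * k + 1)) := by
    rw [← hfg.wedge]
    nlinarith [mul_pos (h.f_even k) (h.g_pos (2 * k + 1)),
      mul_pos (h.g_pos (2 * k)) (neg_pos.2 (h.f_odd k))]
  have h3 := h.det_even k
  have hσ : det2 (v (2 * k)) (v (2 * k + 1)) = σ := by
    rcases Int.eq_one_or_neg_one_of_mul_eq_one h3 with h4 | h4 <;> rw [h4] at h3 ⊢ <;> linarith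
  rw [hσ] at h2
  have hc : 0 < c * c := mul_self_pos.2 hfg.ne_zero
  have h5 : (0 : ℝ) < c * c * (σ * det2 x (v (2 * k + 1))) := by
    have := mul_pos h1 h2
    nlinarith
  have h6 := pos_of_mul_pos_right h5 hc.le
  exact_mod_cast h6

theorem IsBichain.exists_sector (h : IsBichain f g σ v a) (hfg : IsIrrationalFrame f g c)
    {x : IntPt} (hf : 0 ≤ f x) (hg : 0 ≤ g x) (hx : x ≠ 0) :
    ∃ k, 0 ≤ σ * det2 (v (2 * k)) x ∧ 0 < σ * det2 x (v (2 * (k + 1))) := by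
  obtain ⟨k, h1, h2⟩ := exists_sign_change (d := fun k => σ * det2 (v (2 * k)) x) fun k => by
    refine mul_det2_lt (A := fun k => v (2 * k)) (e := fun k => v (2 * k + 1)) (by omega) ?_
    intro j _ _
    exact ⟨(h.isChain j (j + 1)).edge j le_rfl (by omega), h.det2_odd_pos hfg hf hg hx j⟩
  refine ⟨k, h1, ?_⟩
  rw [det2_comm]
  linarith

theorem IsBichain.ne_zero (h : IsBichain f g σ v a) (j : ℤ) : v j ≠ 0 := by
  intro h0
  simpa [h0] using h.g_pos j

/-- The even vectors of a bichain form the sail of the cone `f ≥ 0`, `g ≥ 0`. -/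
theorem IsBichain.isSailLine (h : IsBichain f g σ v a) (hfg : IsIrrationalFrame f g c)
    {C : Set RealPt} (hC : ∀ x, toReal x ∈ C ↔ 0 ≤ f x ∧ 0 ≤ g x) :
    IsSailLine C Set.univ (fun k => v (2 * k)) := by
  have hmem : ∀ k ∈ Set.univ, toReal (v (2 * k)) ∈ C := fun k _ =>
    (hC _).2 ⟨(h.f_even k).le, (h.g_pos _).le⟩
  have hne : ∀ k ∈ Set.univ, v (2 * k) ≠ 0 := fun k _ => h.ne_zero _
  have hpos : ∀ k x, toReal x ∈ C → x ≠ 0 → 0 < σ * det2 x (v (2 * k + 1)) := fun k x hx hx0 =>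
    h.det2_odd_pos hfg ((hC x).1 hx).1 ((hC x).1 hx).2 hx0 k
  refine isSailLine_of_supported (e := fun k => v (2 * k + 1)) (a := fun k => a (2 * k)) (σ := σ)
    hmem hne ?_ ?_ ?_ ?_ ?_ ?_
  · intro x hx
    obtain ⟨h1, h2⟩ := (hC x).1 hx
    refine (hC _).2 ⟨?_, ?_⟩ <;> rw [map_zsmul_real] <;> positivity
  · refine injOn_of_edges (σ := σ) (e := fun k => v (2 * k + 1)) Set.ordConnected_univ hmem hne ?_
    intro k _ _
    exact ⟨(h.isChain k (k + 1)).edge k le_rfl (by omega), hpos k⟩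
  · intro k _ _
    refine ⟨by exact_mod_cast h.pos _, h.det_even k, ?_, hpos k⟩
    rw [← h.step, mul_add, mul_one]
  · intro k _
    have hd : σ * det2 (v (2 * k)) (v (2 * (k - 1) + 1)) = 1 := by
      have := (h.isChain (k - 1) k).det_succ (k := k - 1) le_rfl (by omega)
      simpa using this
    refine ⟨v (2 * (k - 1) + 1), v (2 * k + 1), ?_, fun x hx hx0 => ⟨?_, ?_⟩⟩
    · obtain ⟨b, hb, he⟩ := (h.isChain (k - 1) (k + 1)).vertex k (by omega) (by omega)
      rw [he, det2_add_right, det2_self, zero_add, det2_smul_right, det2_comm]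
      refine mul_ne_zero hb.ne' (neg_ne_zero.2 ?_)
      exact right_ne_zero_of_mul (by rw [hd]; exact one_ne_zero)
    · rw [hd]
      exact hpos (k - 1) x hx hx0
    · rw [h.det_even]
      exact hpos k x hx hx0
  · intro x hx hx0
    obtain ⟨k, h1, h2⟩ := h.exists_sector hfg ((hC x).1 hx).1 ((hC x).1 hx).2 hx0
    exact ⟨k, trivial, trivial, h1, h2.le⟩
  · rintro rfl
    simpa using h.det_even 0

/-- The LLS sequence of the even sail of a bichain is its sequence of partial quotients. -/
theorem IsBichain.absLLS_eq (h : IsBichain f g σ v a) (j : ℤ) :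
    absLLS (fun k => v (2 * k)) j = a j := by
  have hσ : |(σ : ℚ)| = 1 := by
    rcases Int.eq_one_or_neg_one_of_mul_eq_one (h.det_even 0) with h1 | h1 <;> simp [h1]
  have hedge : ∀ k, σ * det2 (v (2 * k)) (v (2 * (k + 1))) = a (2 * k) := by
    intro k
    rw [mul_add, mul_one, h.step, det2_add_right, det2_self, det2_smul_right, zero_add]
    linear_combination (a (2 * k) : ℤ) * h.det_even k
  have hedgeQ : ∀ k, (σ : ℚ) * edgeTerm (fun k => v (2 * k)) k = a (2 * k) := by
    intro k
    unfold edgeTerm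
    exact_mod_cast hedge k
  have hσσ : (σ : ℚ) * σ = 1 := by
    rcases Int.eq_one_or_neg_one_of_mul_eq_one (h.det_even 0) with h1 | h1 <;> simp [h1]
  have hedgeQ' : ∀ k, edgeTerm (fun k => v (2 * k)) k = σ * a (2 * k) := by
    intro k
    rw [← hedgeQ]
    linear_combination -(edgeTerm (fun k => v (2 * k)) k) * hσσ
  unfold absLLS
  split_ifs with hj
  · obtain ⟨k, rfl⟩ := hj
    rw [show (k + k) / 2 = k by omega, hedgeQ', abs_mul, hσ, one_mul, Nat.abs_cast, ← two_mul]
  · obtain ⟨k, rfl⟩ : ∃ k, j = 2 * k - 1 := by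
      obtain ⟨k, rfl⟩ := Int.not_even_iff_odd.1 hj
      exact ⟨k + 1, by ring⟩
    rw [show (2 * k - 1 + 1) / 2 = k by omega]
    unfold vertexTerm
    rw [hedgeQ', hedgeQ']
    have h1 : v (2 * (k - 1)) - v (2 * k) = -((a (2 * (k - 1)) : ℤ) • v (2 * k - 1)) := by
      have := h.step (2 * (k - 1))
      rw [show 2 * (k - 1) + 2 = 2 * k by ring, show 2 * (k - 1) + 1 = 2 * k - 1 by ring] at this
      rw [this]
      abel
    have h2 : v (2 * (k + 1)) - v (2 * k) = (a (2 * k) : ℤ) • v (2 * k + 1) := by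
      rw [mul_add, mul_one, h.step, add_sub_cancel_left]
    have h3 : v (2 * k + 1) = v (2 * k - 1) + (a (2 * k - 1) : ℤ) • v (2 * k) := by
      have := h.step (2 * k - 1)
      rwa [sub_add_cancel, show 2 * k - 1 + 2 = 2 * k + 1 by ring] at this
    have h4 : -σ * det2 (v (2 * k - 1)) (v (2 * k)) = 1 := by
      have := h.det_odd (k - 1)
      rwa [show 2 * (k - 1) + 1 = 2 * k - 1 by ring, show 2 * (k - 1) + 2 = 2 * k by ring] at this
    have h4' : -(σ : ℚ) * det2 (v (2 * k - 1)) (v (2 * k)) = 1 := by exact_mod_cast h4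
    rw [h1, h2, det2_neg_left, det2_smul_left, det2_smul_right, h3, det2_add_right, det2_self,
      zero_add, det2_smul_right]
    have p1 : (a (2 * (k - 1)) : ℚ) ≠ 0 := by exact_mod_cast (h.pos _).ne'
    have p2 : (a (2 * k) : ℚ) ≠ 0 := by exact_mod_cast (h.pos _).ne'
    have hσ0 : (σ : ℚ) ≠ 0 := by
      rintro h0
      simp [h0] at hσσ
    refine Eq.trans (b := |(σ : ℚ) * a (2 * k - 1)|) ?_ (by
      rw [abs_mul, hσ, one_mul, Nat.abs_cast])
    congr 1
    push_cast
    rw [div_eq_iff (by positivity)]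
    linear_combination (a (2 * (k - 1)) : ℚ) * a (2 * k) * a (2 * k - 1) *
      (σ * h4' + det2 (v (2 * k - 1)) (v (2 * k)) * hσσ - σ * hσσ)

end

/-! ### Finite chains: existence, transport and gluing -/

/-- The chain that the continued fraction of `d / x` defines, with a prescribed first edge
direction: the Euclidean algorithm, with the remainders at its even steps taken in
`1, …, divisor`, so that the continued fraction has odd length and the chain ends in an edge. -/
theorem exists_isChain_of_basis {σ : ℤ} (x : ℕ) : ∀ (P e : IntPt) (d : ℤ), σ * det2 P e = 1 →
    0 < x → (x : ℤ) ≤ d → IsCoprime (x : ℤ) d → ∃ (n : ℤ) (A E : ℤ → IntPt), 0 < n ∧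
      IsChain σ A E 0 n ∧ A 0 = P ∧ E 0 = e ∧ A n = (x : ℤ) • P + d • e := by
  induction x using Nat.strong_induction_on with
  | _ x ih =>
  intro P e d hPe hx hxd hco
  rcases (show 1 ≤ x from hx).eq_or_lt with rfl | hx1
  · refine ⟨1, fun k => if k ≤ 0 then P else P + d • e, fun _ => e, one_pos, ⟨?_, ?_, ?_⟩, ?_,
      rfl, ?_⟩
    · intro k h0 h1
      simp [show k = 0 by omega, hPe]
    · intro k h0 h1
      refine ⟨d, by omega, ?_⟩
      simp [show k = 0 by omega]
    · intro k h0 h1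
      omega
    · simp
    · simp
  -- two steps of the Euclidean algorithm for `(d, x)`, both with nonzero remainders
  have hxZ : (0 : ℤ) < x := by exact_mod_cast hx
  set a := d / x with ha
  set r := d % x with hr
  have hdr : r + x * a = d := Int.emod_add_mul_ediv d x
  have hr0 : 0 ≤ r := Int.emod_nonneg _ hxZ.ne'
  have hrx : r < x := Int.emod_lt_of_pos _ hxZ
  have hxr : IsCoprime (x : ℤ) r := by
    rw [← hdr] at hco
    exact hco.of_add_mul_left_right
  have hrpos : 0 < r := by
    refine lt_of_le_of_ne hr0 fun h => ?_
    rw [← h, isCoprime_zero_right, Int.isUnit_iff] at hxr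
    omega
  have hapos : 0 < a := Int.le_ediv_of_mul_le hxZ (by simpa using hxd)
  set b := ((x : ℤ) - 1) / r with hb
  set y := ((x : ℤ) - 1) % r + 1 with hy
  have hyb : y + r * b = x := by
    have := Int.emod_add_mul_ediv ((x : ℤ) - 1) r
    rw [hy, hb]
    linarith
  have hy0 : 0 < y := by
    have := Int.emod_nonneg ((x : ℤ) - 1) hrpos.ne'
    omega
  have hyr : y ≤ r := by
    have := Int.emod_lt_of_pos ((x : ℤ) - 1) hrpos
    omega
  have hbpos : 0 < b := by
    by_contra! h
    nlinarith
  have hcoy : IsCoprime y r := by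
    rw [← hyb] at hxr
    exact hxr.of_add_mul_left_left
  obtain ⟨y', hy'⟩ := Int.eq_ofNat_of_zero_le hy0.le
  have hdet1 : σ * det2 (P + a • e) (e + b • (P + a • e)) = 1 := by
    rw [det2_add_right, det2_smul_right, det2_self, det2_add_left, det2_smul_left, det2_self, ← hPe]
    ring
  obtain ⟨n, A, E, hn, hch, hA0, hE0, hAn⟩ := ih y' (by omega) (P + a • e) (e + b • (P + a • e)) r
    hdet1 (by omega) (by omega) (by rwa [hy'] at hcoy)
  refine ⟨n + 1, fun k => if k ≤ 0 then P else A (k - 1), fun k => if k ≤ 0 then e else E (k - 1),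
    by omega, ⟨?_, ?_, ?_⟩, by simp, by simp, ?_⟩
  · intro k h0 h1
    rcases h0.eq_or_lt with rfl | h0
    · simpa using hPe
    · simp only [if_neg (not_le.2 h0)]
      exact hch.det _ (by omega) (by omega)
  · intro k h0 h1
    rcases h0.eq_or_lt with rfl | h0
    · exact ⟨a, hapos, by simp [hA0]⟩
    · simp only [if_neg (not_le.2 h0), if_neg (show ¬ k + 1 ≤ 0 by omega)]
      obtain ⟨a', ha', h⟩ := hch.edge (k - 1) (by omega) (by omega)
      refine ⟨a', ha', ?_⟩
      rw [← h, sub_add_cancel, add_sub_cancel_right]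
  · intro k h0 h1
    rcases (show 1 ≤ k from h0).eq_or_lt with rfl | h2
    · exact ⟨b, hbpos, by simp [hA0, hE0]⟩
    · simp only [if_neg (not_le.2 h0), if_neg (show ¬ k - 1 ≤ 0 by omega)]
      exact hch.vertex (k - 1) (by omega) (by omega)
  · simp only [if_neg (show ¬ n + 1 ≤ 0 by omega), add_sub_cancel_right]
    rw [hAn, ← hy', ← hyb, ← hdr]
    have : (x : ℤ) = y + r * b := hyb.symm
    rw [this]
    module

theorem isCoprime_of_det {σ : ℤ} {x y : IntPt} (h : σ * det2 x y = 1) :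
    IsCoprime (x 0) (x 1) :=
  ⟨σ * y 1, -(σ * y 0), by rw [← h, det2]; ring⟩

/-- Two primitive vectors are the end points of a chain. -/
theorem exists_isChain {σ : ℤ} (hσ : σ * σ = 1) {P Q : IntPt} (hP : IsCoprime (P 0) (P 1))
    (hQ : IsCoprime (Q 0) (Q 1)) (hPQ : 0 < σ * det2 P Q) :
    ∃ (n : ℤ) (A E : ℤ → IntPt), 0 < n ∧ IsChain σ A E 0 n ∧ A 0 = P ∧ A n = Q := by
  obtain ⟨e₀, he₀⟩ := exists_det2_eq_one hP
  obtain ⟨y, hy⟩ := exists_det2_eq_one hQ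
  set d := σ * det2 P Q with hd
  set x₀ := det2 Q e₀ with hx₀
  -- `e` is the edge direction for which the first coordinate of `Q` is in the range `1, …, d`
  set t := (x₀ - 1) / d with ht
  set x := (x₀ - 1) % d + 1 with hx
  have hxt : x + d * t = x₀ := by
    have := Int.emod_add_mul_ediv (x₀ - 1) d
    rw [hx, ht]
    linarith
  have hx0 : 0 < x := by
    have := Int.emod_nonneg (x₀ - 1) hPQ.ne'
    omega
  have hxd : x ≤ d := by
    have := Int.emod_lt_of_pos (x₀ - 1) hPQ
    omega
  set e := σ • e₀ + t • P with he
  have hPe : σ * det2 P e = 1 := by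
    rw [he, det2_add_right, det2_smul_right, det2_smul_right, det2_self, he₀]
    linarith
  have hQe : σ * det2 Q e = x := by
    rw [he, det2_add_right, det2_smul_right, det2_smul_right, det2_comm Q P, ← hx₀]
    linear_combination x₀ * hσ - hxt + t * hd
  have hQeq : Q = x • P + d • e := by
    have := congrArg (fun z => σ • z) (det2_smul_eq P e Q)
    simp only [smul_add, smul_smul, hPe, hQe, one_smul] at this
    exact this
  have hco : IsCoprime x d := by
    refine ⟨det2 P y, det2 e y, ?_⟩
    rw [hQeq, det2_add_left, det2_smul_left, det2_smul_left] at hy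
    linarith
  obtain ⟨x', hx'⟩ := Int.eq_ofNat_of_zero_le hx0.le
  rw [hx'] at hQeq hco hx0 hxd
  obtain ⟨n, A, E, hn, hch, hA0, -, hAn⟩ := exists_isChain_of_basis x' P e d hPe
    (by exact_mod_cast hx0) hxd hco
  exact ⟨n, A, E, hn, hch, hA0, hAn.trans hQeq.symm⟩

theorem IsChain.shift {σ : ℤ} {A e : ℤ → IntPt} {m n : ℤ} (h : IsChain σ A e m n) (s : ℤ) :
    IsChain σ (fun k => A (k + s)) (fun k => e (k + s)) (m - s) (n - s) where
  det k h1 h2 := h.det _ (by omega) (by omega)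
  edge k h1 h2 := by
    obtain ⟨a, ha, hA⟩ := h.edge (k + s) (by omega) (by omega)
    exact ⟨a, ha, by rw [← hA, add_right_comm]⟩
  vertex k h1 h2 := by
    obtain ⟨a, ha, hA⟩ := h.vertex (k + s) (by omega) (by omega)
    exact ⟨a, ha, by rw [hA, sub_add_eq_add_sub]⟩

theorem act_add (M : Matrix (Fin 2) (Fin 2) ℤ) (x y : IntPt) :
    act M (x + y) = act M x + act M y := Matrix.mulVec_add _ _ _

theorem act_smul (M : Matrix (Fin 2) (Fin 2) ℤ) (m : ℤ) (x : IntPt) :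
    act M (m • x) = m • act M x := Matrix.mulVec_smul _ _ _

theorem act_mul (M N : Matrix (Fin 2) (Fin 2) ℤ) (x : IntPt) :
    act (M * N) x = act M (act N x) := (Matrix.mulVec_mulVec _ _ _).symm

theorem IsChain.map {σ : ℤ} {A e : ℤ → IntPt} {m n : ℤ} (h : IsChain σ A e m n)
    {M : Matrix (Fin 2) (Fin 2) ℤ} (hM : M.det = 1) :
    IsChain σ (fun k => act M (A k)) (fun k => act M (e k)) m n where
  det k h1 h2 := by rw [det2_act, hM, one_mul, h.det k h1 h2]
  edge k h1 h2 := by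
    obtain ⟨a, ha, hA⟩ := h.edge k h1 h2
    exact ⟨a, ha, by rw [hA, act_add, act_smul]⟩
  vertex k h1 h2 := by
    obtain ⟨a, ha, hA⟩ := h.vertex k h1 h2
    exact ⟨a, ha, by rw [hA, act_add, act_smul]⟩

theorem IsChain.glue {σ : ℤ} {A e A' e' : ℤ → IntPt} {m p n : ℤ} (h : IsChain σ A e m p)
    (h' : IsChain σ A' e' p n) (heq : A p = A' p)
    (hj : m < p → p < n → ∃ b : ℤ, 0 < b ∧ e' p = e (p - 1) + b • A p) :
    IsChain σ (fun k => if k ≤ p then A k else A' k) (fun k => if k < p then e k else e' k)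
      m n := by
  have hA' : ∀ k, p ≤ k → (if k ≤ p then A k else A' k) = A' k := by
    intro k hk
    split_ifs with h1
    · rw [le_antisymm h1 hk, heq]
    · rfl
  refine ⟨fun k h1 h2 => ?_, fun k h1 h2 => ?_, fun k h1 h2 => ?_⟩
  · rcases lt_or_ge k p with hk | hk
    · simp only [if_pos hk, if_pos hk.le]
      exact h.det k h1 hk
    · simp only [hA' k hk, if_neg (not_lt.2 hk)]
      exact h'.det k hk h2
  · rcases lt_or_ge k p with hk | hk
    · simp only [if_pos hk, if_pos hk.le, if_pos (show k + 1 ≤ p from hk)]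
      exact h.edge k h1 hk
    · simp only [hA' k hk, hA' (k + 1) (by omega), if_neg (not_lt.2 hk)]
      exact h'.edge k hk h2
  · rcases lt_trichotomy k p with hk | rfl | hk
    · simp only [if_pos hk, if_pos hk.le, if_pos (show k - 1 < p by omega)]
      exact h.vertex k h1 hk
    · simp only [lt_irrefl, if_false, le_refl, if_true, if_pos (show k - 1 < k by omega)]
      exact hj h1 h2
    · simp only [hA' k hk.le, if_neg (not_lt.2 hk.le), if_neg (show ¬ k - 1 < p by omega)]
      exact h'.vertex k hk h2

theorem eq_add_smul_of_det {σ : ℤ} {x y z : IntPt} (hy : σ * det2 x y = 1)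
    (hz : σ * det2 x z = 1) : z = y + (σ * det2 z y) • x := by
  have := congrArg (fun z => σ • z) (det2_smul_eq x y z)
  simp only [smul_add, smul_smul, hy, hz, one_smul] at this
  rw [add_comm]
  exact this

/-- A chain arriving at the vertex `x` of a sail with edge directions `w`, `z` at `x`, whose last
edge has direction `y` and starts beyond the supporting lines of the sail, is locally convex at
`x` when continued along the sail. -/
theorem exists_join_left {σ b m : ℤ} {x y z w : IntPt} (hy : σ * det2 x y = 1)
    (hw : σ * det2 x w = 1) (hz : z = w + b • x) (hb : 0 < b) (hm : 0 < m)
    (h1 : 0 < σ * det2 (x - m • y) z) (h2 : 0 < σ * det2 (x - m • y) w) :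
    ∃ b' : ℤ, 0 < b' ∧ z = y + b' • x := by
  have hxz : σ * det2 x z = 1 := by
    rw [hz, det2_add_right, det2_smul_right, det2_self, mul_zero, add_zero, hw]
  have hzy := eq_add_smul_of_det hy hxz
  refine ⟨_, ?_, hzy⟩
  rw [det2_sub_left, det2_smul_left, mul_sub, hxz, det2_comm y z] at h1
  have h3 : 0 ≤ σ * det2 z y := by
    by_contra! h
    nlinarith
  refine lt_of_le_of_ne h3 fun h0 => ?_
  rw [← h0, zero_smul, add_zero] at hzy
  rw [← hzy, hz, det2_sub_left, det2_smul_left, det2_add_left, det2_smul_left, det2_self] at h2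
  have : σ * (det2 x w - m * (0 + b * det2 x w)) = 1 - m * b := by
    linear_combination (1 - m * b) * hw
  rw [this] at h2
  nlinarith

/-- The counterpart of `exists_join_left` for a chain that leaves the sail at `x`. -/
theorem exists_join_right {σ b m : ℤ} {x y z w : IntPt} (hy : σ * det2 x y = 1)
    (hw : σ * det2 x w = 1) (hz : z = w + b • x) (hb : 0 < b) (hm : 0 < m)
    (h1 : 0 < σ * det2 (x + m • y) w) (h2 : 0 < σ * det2 (x + m • y) z) :
    ∃ b' : ℤ, 0 < b' ∧ y = w + b' • x := by
  have hyw := eq_add_smul_of_det hw hy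
  refine ⟨_, ?_, hyw⟩
  rw [det2_add_left, det2_smul_left, mul_add, hw] at h1
  have h3 : 0 ≤ σ * det2 y w := by
    by_contra! h
    nlinarith
  refine lt_of_le_of_ne h3 fun h0 => ?_
  rw [← h0, zero_smul, add_zero] at hyw
  rw [hyw, hz, det2_add_left, det2_smul_left, det2_add_right, det2_add_right, det2_smul_right,
    det2_smul_right, det2_self, det2_self, det2_comm w x] at h2
  have : σ * (det2 x w + b * 0 + m * (0 + b * -det2 x w)) = 1 - m * b := by
    linear_combination (1 - m * b) * hw
  rw [this] at h2
  nlinarith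

theorem act_pow_of_shift {v : ℤ → IntPt} {N : Matrix (Fin 2) (Fin 2) ℤ} {n : ℤ}
    (hN : ∀ j, act N (v j) = v (j + 2 * n)) (k : ℕ) (j : ℤ) :
    act (N ^ k) (v j) = v (j + 2 * (k * n)) := by
  induction k generalizing j with
  | zero => simp
  | succ k ih =>
    rw [pow_succ, act_mul, hN, ih]
    congr 1
    push_cast
    ring

/-- The sails of the angles from `P` to `N ^ k P`: an initial part that does not depend on `k`, then
`k` periods of the sail of the cone, then an end part that is transported by `N`. -/
theorem exists_angle_chains {f g : IntPt →+ ℝ} {c : ℝ} {σ : ℤ} {v : ℤ → IntPt} {a : ℤ → ℕ}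
    (h : IsBichain f g σ v a) (hfg : IsIrrationalFrame f g c)
    {N : Matrix (Fin 2) (Fin 2) ℤ} (hNdet : N.det = 1) {n : ℤ} (hn : 0 < n)
    (hN : ∀ j, act N (v j) = v (j + 2 * n))
    {P : IntPt} (hP : IsCoprime (P 0) (P 1)) (hfP : 0 < f P) (hgP : 0 < g P)
    (hs1 : 0 ≤ σ * det2 (v 0) P) (hs2 : 0 < σ * det2 P (v 2)) :
    ∃ (l r : ℤ) (B E : ℕ → ℤ → IntPt), l ≤ 0 ∧ 0 ≤ r ∧
      (∀ k, 2 ≤ k → IsChain σ (B k) (E k) l (r + k * n)) ∧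
      (∀ k, B k l = P) ∧ (∀ k : ℕ, 1 ≤ k → B k (r + k * n) = act (N ^ k) P) ∧
      (∀ (k : ℕ) (j : ℤ), 1 ≤ j → j ≤ k * n → B k j = v (2 * j)) ∧
      (∀ (k : ℕ) (j : ℤ), j ≤ k * n → B (k + 1) j = B k j) ∧
      ∀ (k : ℕ) (j : ℤ), 1 ≤ j → B (k + 1) (j + n) = act N (B k j) := by
  have hσ : σ * σ = 1 := by
    rcases Int.eq_one_or_neg_one_of_mul_eq_one (h.det_even 0) with h1 | h1 <;> simp [h1]
  have hP0 : P ≠ 0 := by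
    rintro rfl
    simp at hfP
  have hv0 : IsCoprime (v 0 0) (v 0 1) := isCoprime_of_det (by simpa using h.det_even 0)
  have hv2 : IsCoprime (v 2 0) (v 2 1) := isCoprime_of_det (by simpa using h.det_even 1)
  have hf0 : 0 < f (v 0) := by simpa using h.f_even 0
  have hf2 : 0 < f (v 2) := by simpa using h.f_even 1
  -- the part of the sail before it joins the sail of the cone
  obtain ⟨l, L, eL, hl, hL, hLl, hL1⟩ : ∃ (l : ℤ) (L eL : ℤ → IntPt), l ≤ 0 ∧
      IsChain σ L eL l 1 ∧ L l = P ∧ L 1 = v 2 := by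
    obtain ⟨q, A, E, hq, hch, hA0, hAq⟩ := exists_isChain hσ hP hv2 hs2
    refine ⟨1 - q, fun k => A (k + (q - 1)), fun k => E (k + (q - 1)), by omega, ?_, ?_, ?_⟩
    · have := hch.shift (q - 1)
      rwa [show 0 - (q - 1) = 1 - q by ring, show q - (q - 1) = 1 by ring] at this
    · simp [hA0]
    · simp [hAq]
  -- the part of the sail after it leaves the sail of the cone
  obtain ⟨r, R, eR, hr, hR, hR0, hRr⟩ : ∃ (r : ℤ) (R eR : ℤ → IntPt), 0 ≤ r ∧
      IsChain σ R eR 0 r ∧ R 0 = v 0 ∧ R r = P := by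
    rcases hs1.eq_or_lt with h0 | hs1
    · refine ⟨0, fun _ => v 0, fun _ => 0, le_rfl, ⟨?_, ?_, ?_⟩, rfl, ?_⟩
      · intro k _ _; omega
      · intro k _ _; omega
      · intro k _ _; omega
      · have hd : σ * det2 (v 0) (v 1) = 1 := by simpa using h.det_even 0
        have hpos : 0 < σ * det2 P (v 1) := by
          simpa using h.det2_odd_pos hfg hfP.le hgP.le hP0 0
        have hPv : P = (σ * det2 P (v 1)) • v 0 := by
          have := congrArg (fun z => σ • z) (det2_smul_eq (v 0) (v 1) P)
          simpa only [smul_add, smul_smul, hd, one_smul, ← h0, zero_smul, add_zero] using this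
        obtain ⟨y, hy⟩ := exists_det2_eq_one hP
        rw [hPv, det2_smul_left] at hy
        have : σ * det2 P (v 1) = 1 := by
          rcases Int.eq_one_or_neg_one_of_mul_eq_one hy with h1 | h1 <;> omega
        rw [this, one_smul] at hPv
        exact hPv.symm
    · obtain ⟨r, R, eR, hr, hch, h0, h1⟩ := exists_isChain hσ hv0 hP hs1
      exact ⟨r, R, eR, hr.le, hch, h0, h1⟩
  have hdetk : ∀ k : ℕ, (N ^ k).det = 1 := fun k => by rw [Matrix.det_pow, hNdet, one_pow]
  have hvk := act_pow_of_shift hN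
  have hjoinL : ∃ b : ℤ, 0 < b ∧ v 3 = eL 0 + b • v 2 := by
    obtain ⟨m, hm, hLm⟩ := hL.edge 0 hl (by omega)
    have hy := hL.det_succ (k := 0) hl (by omega)
    rw [zero_add, hL1] at hLm hy
    have hw := (h.isChain 0 1).det_succ (k := 0) le_rfl (by omega)
    have hz := h.step 1
    have hL0 : v 2 - m • eL 0 = L 0 := by rw [hLm, add_sub_cancel_right]
    have hLne : L 0 ≠ 0 := by
      intro h0
      have := hL.det 0 hl (by omega)
      simp [h0] at this
    have hfL : 0 ≤ f (L 0) := hL.map_nonneg f (by rw [hLl]; exact hfP.le)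
      (by rw [hL1]; exact hf2.le) hl (by omega)
    have hgL : 0 ≤ g (L 0) := hL.map_nonneg g (by rw [hLl]; exact hgP.le)
      (by rw [hL1]; exact (h.g_pos _).le) hl (by omega)
    refine exists_join_left (w := v 1) hy (by simpa using hw) hz (by exact_mod_cast h.pos 1) hm
      ?_ ?_
    · rw [hL0]
      simpa using h.det2_odd_pos hfg hfL hgL hLne 1
    · rw [hL0]
      simpa using h.det2_odd_pos hfg hfL hgL hLne 0
  have hjoinR : 0 < r → ∃ b : ℤ, 0 < b ∧ eR 0 = v (-1) + b • v 0 := by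
    intro hr0
    obtain ⟨m, hm, hRm⟩ := hR.edge 0 le_rfl hr0
    have hy := hR.det 0 le_rfl hr0
    rw [zero_add, hR0] at hRm
    rw [hR0] at hy
    have hw := (h.isChain (-1) 1).det_succ (k := -1) (by omega) (by omega)
    have hz : v 1 = v (-1) + (a (-1) : ℤ) • v 0 := by simpa using h.step (-1)
    have hRne : R 1 ≠ 0 := by
      intro h0
      have := hR.det_succ (k := 0) le_rfl hr0
      simp [h0] at this
    have hfR : 0 ≤ f (R 1) := hR.map_nonneg f (by rw [hR0]; exact hf0.le)
      (by rw [hRr]; exact hfP.le) (by omega) (by omega)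
    have hgR : 0 ≤ g (R 1) := hR.map_nonneg g (by rw [hR0]; exact (h.g_pos _).le)
      (by rw [hRr]; exact hgP.le) (by omega) (by omega)
    refine exists_join_right (z := v 1) hy (by simpa using hw) hz (by exact_mod_cast h.pos _) hm
      ?_ ?_
    · rw [← hRm]
      simpa using h.det2_odd_pos hfg hfR hgR hRne (-1)
    · rw [← hRm]
      simpa using h.det2_odd_pos hfg hfR hgR hRne 0
  let B : ℕ → ℤ → IntPt := fun k j =>
    if j ≤ k * n then if j ≤ 1 then L j else v (2 * j) else act (N ^ k) (R (j - k * n))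
  let E : ℕ → ℤ → IntPt := fun k j =>
    if j < k * n then if j < 1 then eL j else v (2 * j + 1) else act (N ^ k) (eR (j - k * n))
  have hBv : ∀ (k : ℕ) (j : ℤ), 1 ≤ j → j ≤ k * n → B k j = v (2 * j) := by
    intro k j h1 h2
    simp only [B, if_pos h2]
    split_ifs with h3
    · rw [le_antisymm h3 h1, hL1]
      rfl
    · rfl
  have hBR : ∀ (k : ℕ) (j : ℤ), 1 ≤ k → k * n ≤ j → B k j = act (N ^ k) (R (j - k * n)) := by
    intro k j hk h1
    rcases h1.eq_or_lt with rfl | h1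
    · have : (1 : ℤ) ≤ k * n := by
        have : (1 : ℤ) ≤ k := by exact_mod_cast hk
        nlinarith
      rw [hBv k _ this le_rfl, sub_self, hR0, hvk, zero_add]
    · simp only [B, if_neg (not_le.2 h1)]
  have hkn : ∀ k : ℕ, (0 : ℤ) ≤ k * n := fun k => by positivity
  refine ⟨l, r, B, E, hl, hr, ?_, ?_, ?_, hBv, ?_, ?_⟩
  · intro k hk
    have hk2 : (2 : ℤ) ≤ k * n := by
      have : (2 : ℤ) ≤ k := by exact_mod_cast hk
      nlinarith
    have hglue := hL.glue (h.isChain 1 (k * n)) hL1 (fun _ _ => by simpa [hL1] using hjoinL)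
    have hRk := (hR.map (hdetk k)).shift (-(k * n))
    rw [show 0 - -((k : ℤ) * n) = k * n by ring, show r - -((k : ℤ) * n) = r + k * n by ring]
      at hRk
    refine hglue.glue hRk ?_ ?_
    · simp only [if_neg (show ¬ (k : ℤ) * n ≤ 1 by omega), sub_self, hR0, hvk, zero_add]
    · intro _ h2
      obtain ⟨b, hb, hbe⟩ := hjoinR (by omega)
      refine ⟨b, hb, ?_⟩
      simp only [if_neg (show ¬ (k : ℤ) * n ≤ 1 by omega),
        if_neg (show ¬ (k : ℤ) * n - 1 < 1 by omega), sub_self, hbe, act_add, act_smul, hvk]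
      rw [zero_add, show 2 * ((k : ℤ) * n - 1) + 1 = -1 + 2 * (k * n) by ring]
  · intro k
    simp only [B, if_pos (hl.trans (hkn k)), if_pos (show l ≤ 1 by omega), hLl]
  · intro k hk
    rw [hBR k _ hk (by omega), add_sub_cancel_right, hRr]
  · intro k j hj
    have : j ≤ ((k + 1 : ℕ) : ℤ) * n := by
      push_cast
      nlinarith
    simp only [B, if_pos this, if_pos hj]
  · intro k j hj
    rcases le_or_gt j (k * n) with h1 | h1
    · rw [hBv k j hj h1, hBv (k + 1) _ (by omega) (by push_cast; linarith), hN, mul_add]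
    · rw [hBR (k + 1) _ (by omega) (by push_cast; linarith)]
      simp only [B, if_neg (not_le.2 h1)]
      rw [← act_mul, ← pow_succ']
      congr 2
      push_cast
      ring

/-! ### The eigenforms of a hyperbolic matrix -/

/-- The restriction of a real linear form to the integer lattice. -/
noncomputable def latticeForm (F : RealPt →ₗ[ℝ] ℝ) : IntPt →+ ℝ :=
  AddMonoidHom.mk' (fun x => F (toReal x)) fun x y => by
    rw [← map_add]
    congr 1
    ext i
    simp

@[simp] theorem latticeForm_apply (F : RealPt →ₗ[ℝ] ℝ) (x : IntPt) :
    latticeForm F x = F (toReal x) := rfl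

theorem realOp_apply (M : Matrix (Fin 2) (Fin 2) ℤ) (u : RealPt) (i : Fin 2) :
    realOp M u i = M i 0 * u 0 + M i 1 * u 1 := by
  simp [realOp, Matrix.toLin'_apply, Matrix.mulVec, dotProduct, Fin.sum_univ_two]

theorem toReal_act (M : Matrix (Fin 2) (Fin 2) ℤ) (x : IntPt) :
    toReal (act M x) = realOp M (toReal x) := by
  ext i
  rw [realOp_apply, toReal_apply, act, Matrix.mulVec, dotProduct, Fin.sum_univ_two]
  push_cast
  rfl

theorem charpoly_of_hasEigenvalue {M : Matrix (Fin 2) (Fin 2) ℤ} {l : ℝ}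
    (h : (realOp M).HasEigenvalue l) :
    l * l - (M 0 0 + M 1 1) * l + (M 0 0 * M 1 1 - M 0 1 * M 1 0) = 0 := by
  obtain ⟨u, hu⟩ := h.exists_hasEigenvector
  have h0 := congrFun hu.apply_eq_smul 0
  have h1 := congrFun hu.apply_eq_smul 1
  rw [realOp_apply, Pi.smul_apply, smul_eq_mul] at h0 h1
  by_contra hne
  apply hu.2
  ext i
  apply mul_left_cancel₀ hne
  fin_cases i
  · simp only [Fin.zero_eta, Fin.isValue, Pi.zero_apply, mul_zero]
    linear_combination (M 1 1 - l) * h0 - M 0 1 * h1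
  · simp only [Fin.mk_one, Fin.isValue, Pi.zero_apply, mul_zero]
    linear_combination (M 0 0 - l) * h1 - M 1 0 * h0

/-- The left eigenvector of `M` for the eigenvalue `l`, as a linear form. -/
noncomputable def eigenform (M : Matrix (Fin 2) (Fin 2) ℤ) (l : ℝ) : RealPt →ₗ[ℝ] ℝ :=
  (M 1 0 : ℝ) • LinearMap.proj 0 + (l - M 0 0) • LinearMap.proj 1

theorem eigenform_apply (M : Matrix (Fin 2) (Fin 2) ℤ) (l : ℝ) (u : RealPt) :
    eigenform M l u = M 1 0 * u 0 + (l - M 0 0) * u 1 := by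
  simp [eigenform]

theorem eigenform_realOp {M : Matrix (Fin 2) (Fin 2) ℤ} {l : ℝ}
    (h : (realOp M).HasEigenvalue l) (u : RealPt) :
    eigenform M l (realOp M u) = l * eigenform M l u := by
  simp only [eigenform_apply, realOp_apply]
  linear_combination -(u 1) * charpoly_of_hasEigenvalue h

theorem apply_one_zero_ne_zero {M : Matrix (Fin 2) (Fin 2) ℤ} {l : ℝ} (hl : Irrational l)
    (h : (realOp M).HasEigenvalue l) : (M 1 0 : ℝ) ≠ 0 := by
  intro h0
  have hc := charpoly_of_hasEigenvalue h
  have : (l - M 0 0) * (l - M 1 1) = 0 := by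
    rw [h0] at hc
    linear_combination hc
  rcases mul_eq_zero.1 this with h1 | h1
  · exact hl.ne_int (M 0 0) (by linarith)
  · exact hl.ne_int (M 1 1) (by linarith)

theorem eq_zero_of_eigenform {M : Matrix (Fin 2) (Fin 2) ℤ} {l : ℝ} (hl : Irrational l)
    (h : (realOp M).HasEigenvalue l) {x : IntPt} (hx : eigenform M l (toReal x) = 0) : x = 0 := by
  have hr := apply_one_zero_ne_zero hl h
  rw [eigenform_apply] at hx
  simp only [toReal_apply] at hx
  have h1 : x 1 = 0 := by
    by_contra h1
    have h1R : (x 1 : ℝ) ≠ 0 := by exact_mod_cast h1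
    have hl' : l = ((M 0 0 - M 1 0 * x 0 / x 1 : ℚ) : ℝ) := by
      push_cast
      field_simp
      linarith
    exact hl ⟨_, hl'.symm⟩
  have h0 : x 0 = 0 := by
    rw [h1] at hx
    have : (M 1 0 : ℝ) * x 0 = 0 := by simpa using hx
    exact_mod_cast (mul_eq_zero.1 this).resolve_left hr
  ext i
  fin_cases i
  · exact h0
  · exact h1

/-- Real linear coordinates `F`, `G` of the plane in which `M` is diagonal, with the expanded
coordinate `G`, and whose signs are chosen so that the given lattice point lies in the open first
quadrant. -/
theorem exists_eigenforms {M : Matrix (Fin 2) (Fin 2) ℤ} (hdet : M.det = 1 ∨ M.det = -1)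
    (hM : ∃ a b : ℝ, a ≠ b ∧ Irrational a ∧ Irrational b ∧ (realOp M).HasEigenvalue a ∧
      (realOp M).HasEigenvalue b) {P : IntPt} (hP : P ≠ 0) :
    ∃ (α β c : ℝ) (F G : RealPt →ₗ[ℝ] ℝ), 1 < |α| ∧ β ≠ 0 ∧ α ≠ β ∧
      (∀ l, (realOp M).HasEigenvalue l → l = α ∨ l = β) ∧
      (∀ u, F (realOp M u) = β * F u) ∧ (∀ u, G (realOp M u) = α * G u) ∧
      (∀ u, F u = 0 → G u = 0 → u = 0) ∧
      IsIrrationalFrame (latticeForm F) (latticeForm G) c ∧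
      0 < F (toReal P) ∧ 0 < G (toReal P) := by
  obtain ⟨α, β, hne, hα, hβ, hMα, hMβ, hlt⟩ : ∃ a b : ℝ, a ≠ b ∧ Irrational a ∧ Irrational b ∧
      (realOp M).HasEigenvalue a ∧ (realOp M).HasEigenvalue b ∧ 1 < |a| := by
    obtain ⟨a, b, hne, ha, hb, hMa, hMb⟩ := hM
    by_cases h1 : 1 < |a|
    · exact ⟨a, b, hne, ha, hb, hMa, hMb, h1⟩
    · refine ⟨b, a, hne.symm, hb, ha, hMb, hMa, ?_⟩
      have hprod : a * b = M.det := by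
        have h2 := charpoly_of_hasEigenvalue hMa
        have h3 := charpoly_of_hasEigenvalue hMb
        rw [Matrix.det_fin_two]
        push_cast
        apply mul_left_cancel₀ (sub_ne_zero.2 hne)
        linear_combination b * h2 - a * h3
      have habs : |a| * |b| = 1 := by
        rw [← abs_mul, hprod]
        rcases hdet with h | h <;> simp [h]
      have ha1 : |a| ≠ 1 := by
        intro h
        rcases (abs_eq zero_le_one).1 h with h | h
        · exact ha.ne_one h
        · exact ha.ne_int (-1) (by simpa using h)
      have ha2 : |a| < 1 := lt_of_le_of_ne (not_lt.1 h1) ha1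
      have ha0 : 0 < |a| := abs_pos.2 ha.ne_zero
      nlinarith [abs_nonneg b]
  have hr := apply_one_zero_ne_zero hα hMα
  have hsgn : ∀ l, Irrational l → (realOp M).HasEigenvalue l → ∃ s : ℝ, s ≠ 0 ∧
      0 < s * eigenform M l (toReal P) := by
    intro l hl hMl
    have : eigenform M l (toReal P) ≠ 0 := fun h => hP (eq_zero_of_eigenform hl hMl h)
    exact ⟨_, this, mul_self_pos.2 this⟩
  obtain ⟨s, hs, hsP⟩ := hsgn β hβ hMβ
  obtain ⟨t, ht, htP⟩ := hsgn α hα hMα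
  refine ⟨α, β, s * t * (M 1 0 * (α - β)), s • eigenform M β, t • eigenform M α, hlt, hβ.ne_zero,
    hne, ?_, ?_, ?_, ?_, ⟨?_, ?_, ?_, ?_⟩, hsP, htP⟩
  · intro l hl
    have h1 := charpoly_of_hasEigenvalue hMα
    have h2 := charpoly_of_hasEigenvalue hMβ
    have h3 := charpoly_of_hasEigenvalue hl
    have : (α - β) * ((l - α) * (l - β)) = 0 := by
      linear_combination (α - β) * h3 - (l - β) * h1 + (l - α) * h2
    rcases mul_eq_zero.1 ((mul_eq_zero.1 this).resolve_left (sub_ne_zero.2 hne)) with h | h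
    · exact Or.inl (sub_eq_zero.1 h)
    · exact Or.inr (sub_eq_zero.1 h)
  · intro u
    simp only [LinearMap.smul_apply, smul_eq_mul, eigenform_realOp hMβ]
    ring
  · intro u
    simp only [LinearMap.smul_apply, smul_eq_mul, eigenform_realOp hMα]
    ring
  · intro u hF hG
    simp only [LinearMap.smul_apply, smul_eq_mul, mul_eq_zero, hs, ht, false_or,
      eigenform_apply] at hF hG
    have h1 : u 1 = 0 := by
      have : (α - β) * u 1 = 0 := by linear_combination hG - hF
      exact (mul_eq_zero.1 this).resolve_left (sub_ne_zero.2 hne)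
    have h0 : u 0 = 0 := by
      rw [h1, mul_zero, add_zero] at hF
      exact (mul_eq_zero.1 hF).resolve_left hr
    ext i
    fin_cases i
    · exact h0
    · exact h1
  · intro x hx
    refine eq_zero_of_eigenform hβ hMβ ?_
    simpa [hs] using hx
  · intro x hx
    refine eq_zero_of_eigenform hα hMα ?_
    simpa [ht] using hx
  · exact mul_ne_zero (mul_ne_zero hs ht) (mul_ne_zero hr (sub_ne_zero.2 hne))
  · intro x y
    simp only [latticeForm_apply, LinearMap.smul_apply, smul_eq_mul, eigenform_apply, toReal_apply,
      det2]
    push_cast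
    ring

/-- In the coordinates given by the eigenforms each associated cone is a quadrant. -/
theorem IsAssociatedCone.exists_signs {M : Matrix (Fin 2) (Fin 2) ℤ} {α β : ℝ}
    {F G : RealPt →ₗ[ℝ] ℝ} (hne : α ≠ β)
    (hroots : ∀ l, (realOp M).HasEigenvalue l → l = α ∨ l = β)
    (hF : ∀ u, F (realOp M u) = β * F u) (hG : ∀ u, G (realOp M u) = α * G u)
    (hsep : ∀ u, F u = 0 → G u = 0 → u = 0) {C : Set RealPt} (hC : IsAssociatedCone M C) :
    ∃ p q : ℝ, p ≠ 0 ∧ q ≠ 0 ∧ ∀ x, x ∈ C ↔ 0 ≤ p * F x ∧ 0 ≤ q * G x := by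
  have key : ∀ u v, (realOp M).HasEigenvector α u → (realOp M).HasEigenvector β v →
      F v ≠ 0 ∧ G u ≠ 0 ∧ ∀ x, x ∈ angle u v ↔ 0 ≤ F v * F x ∧ 0 ≤ G u * G x := by
    intro u v hu hv
    have hFu : F u = 0 := by
      have := hF u
      rw [hu.apply_eq_smul, map_smul, smul_eq_mul] at this
      have h : (α - β) * F u = 0 := by linear_combination this
      exact (mul_eq_zero.1 h).resolve_left (sub_ne_zero.2 hne)
    have hGv : G v = 0 := by
      have := hG v
      rw [hv.apply_eq_smul, map_smul, smul_eq_mul] at this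
      have h : (α - β) * G v = 0 := by linear_combination -this
      exact (mul_eq_zero.1 h).resolve_left (sub_ne_zero.2 hne)
    have hFv : F v ≠ 0 := fun h => hv.2 (hsep v h hGv)
    have hGu : G u ≠ 0 := fun h => hu.2 (hsep u hFu h)
    refine ⟨hFv, hGu, fun x => ⟨?_, ?_⟩⟩
    · rintro ⟨s, t, hs, ht, rfl⟩
      simp only [map_add, map_smul, smul_eq_mul, hFu, hGv, mul_zero, zero_add, add_zero]
      constructor
      · rw [mul_left_comm]
        exact mul_nonneg ht (mul_self_nonneg _)
      · rw [mul_left_comm]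
        exact mul_nonneg hs (mul_self_nonneg _)
    · rintro ⟨h1, h2⟩
      refine ⟨G x / G u, F x / F v, ?_, ?_, ?_⟩
      · rw [← mul_div_mul_left _ _ hGu]
        exact div_nonneg h2 (mul_self_nonneg _)
      · rw [← mul_div_mul_left _ _ hFv]
        exact div_nonneg h1 (mul_self_nonneg _)
      · refine sub_eq_zero.1 (hsep _ ?_ ?_)
        · simp only [map_sub, map_add, map_smul, smul_eq_mul, hFu]
          field_simp
          ring
        · simp only [map_sub, map_add, map_smul, smul_eq_mul, hGv]
          field_simp
          ring
  obtain ⟨a, b, u, v, hab, hu, hv, rfl⟩ := hC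
  have ha := hroots a (Module.End.hasEigenvalue_of_hasEigenvector hu)
  have hb := hroots b (Module.End.hasEigenvalue_of_hasEigenvector hv)
  rcases ha with rfl | rfl
  · rcases hb with rfl | rfl
    · exact absurd rfl hab
    · obtain ⟨h1, h2, h3⟩ := key u v hu hv
      exact ⟨_, _, h1, h2, h3⟩
  · rcases hb with rfl | rfl
    · obtain ⟨h1, h2, h3⟩ := key v u hv hu
      refine ⟨_, _, h1, h2, fun x => ?_⟩
      rw [← h3]
      constructor <;> rintro ⟨s, t, hs, ht, rfl⟩ <;> exact ⟨t, s, ht, hs, add_comm _ _⟩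
    · exact absurd rfl hab

/-! ### Periods and differences -/

/-- The entry of index `j` depends only on the two or three vertices around it, and it is invariant
under orientation-preserving automorphisms of the lattice. -/
theorem absLLS_congr {A A' : ℤ → IntPt} {N : Matrix (Fin 2) (Fin 2) ℤ} (hN : N.det = 1)
    {s j : ℤ} (h : ∀ i, j ≤ 2 * i + 1 → 2 * i ≤ j + 3 → A' (i + s) = act N (A i)) :
    absLLS A' (j + 2 * s) = absLLS A j := by
  have hedge : ∀ k, j ≤ 2 * k + 1 → 2 * k + 2 ≤ j + 3 → edgeTerm A' (k + s) = edgeTerm A k := by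
    intro k h1 h2
    unfold edgeTerm
    rw [show k + s + 1 = k + 1 + s by ring, h k h1 (by omega), h (k + 1) (by omega) (by omega),
      det2_act, hN, one_mul]
  have hpar : Even (j + 2 * s) ↔ Even j := by
    simp [Int.even_add]
  unfold absLLS
  simp only [hpar]
  split_ifs with hj
  · obtain ⟨k, rfl⟩ := hj
    rw [show (k + k + 2 * s) / 2 = k + s by omega, show (k + k) / 2 = k by omega,
      hedge k (by omega) (by omega)]
  · obtain ⟨k, rfl⟩ := Int.not_even_iff_odd.1 hj
    rw [show (2 * k + 1 + 2 * s + 1) / 2 = k + 1 + s by omega,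
      show (2 * k + 1 + 1) / 2 = k + 1 by omega]
    unfold vertexTerm
    have e1 := hedge (k + 1) (by omega) (by omega)
    have e2 := hedge k (by omega) (by omega)
    rw [e1, show k + 1 + s - 1 = k + s by ring, show k + 1 - 1 = k by ring, e2,
      show k + 1 + s + 1 = k + 1 + 1 + s by ring, h (k + 1) (by omega) (by omega),
      h (k + 1 + 1) (by omega) (by omega), h k (by omega) (by omega)]
    have hsub : ∀ x y, act N x - act N y = act N (x - y) := fun x y =>
      (Matrix.mulVec_sub _ _ _).symm
    rw [hsub, hsub, det2_act, hN, one_mul]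

/-- Two finite sequences that agree up to the insertion, at some position, of two periods of a
periodic sequence: their difference is a rotation of these two periods. -/
theorem exists_isDifference {X Y : ℕ → ℚ} {b : ℕ → ℕ} {L n p : ℕ} (hn : 0 < n) (hpL : p ≤ L)
    (hXY : ∀ j, j < p → X j = Y j) (hYX : ∀ j, p ≤ j → Y (j + 2 * n) = X j)
    (hYb : ∀ j, p ≤ j → j < p + 2 * n → Y j = b j) (hb : ∀ j, b (j + n) = b j) :
    ∃ k : ℕ, IsDifference ((List.range (L + 2 * n)).map Y) ((List.range L).map X)
      ((List.ofFn (fun i : Fin n => b (k + i)) ++ List.ofFn (fun i : Fin n => b (k + i))).map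
        (fun x : ℕ => (x : ℚ))) := by
  classical
  have hex : ∃ k, k = L ∨ X k ≠ Y k := ⟨L, Or.inl rfl⟩
  set k := Nat.find hex with hk
  have hkL : k ≤ L := Nat.find_min' hex (Or.inl rfl)
  have hbefore : ∀ j, j < k → X j = Y j := by
    intro j hj
    have := Nat.find_min hex hj
    push Not at this
    exact this.2
  have hpk : p ≤ k := by
    by_contra! h
    rcases Nat.find_spec hex with h1 | h1
    · omega
    · exact h1 (hXY _ h)
  have hYb' : ∀ j, p ≤ j → j < k + 2 * n → Y j = b j := by
    intro j
    induction j using Nat.strong_induction_on with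
    | _ j ih =>
    intro h1 h2
    rcases lt_or_ge j (p + 2 * n) with h3 | h3
    · exact hYb j h1 h3
    · obtain ⟨i, rfl⟩ : ∃ i, j = i + 2 * n := ⟨j - 2 * n, by omega⟩
      rw [hYX i (by omega), hbefore i (by omega), ih i (by omega) (by omega) (by omega),
        show i + 2 * n = i + n + n by ring, hb, hb]
  refine ⟨k, by simp [hn], k, by simpa using hkL, ?_, ?_, ?_, ?_⟩
  · intro i hi
    rw [List.getElem?_eq_getElem (by simp; omega), List.getElem?_eq_getElem (by simp; omega)]
    simp [hbefore i hi]
  · rcases Nat.find_spec hex with h1 | h1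
    · left
      simpa using h1
    · rcases hkL.eq_or_lt with h2 | h2
      · left
        simpa using h2
      · right
        rw [List.getElem?_eq_getElem (by simp; omega), List.getElem?_eq_getElem (by simp; omega)]
        simpa using h1
  · intro i h1 h2
    simp only [List.length_map, List.length_range] at h2 ⊢
    rw [Nat.add_sub_cancel_left, List.getElem?_eq_getElem (by simp; omega),
      List.getElem?_eq_getElem (by simp; omega)]
    simp [hYX i (by omega)]
  · simp only [List.length_map, List.length_range, Nat.add_sub_cancel_left]
    apply List.ext_getElem
    · simp
      omega
    · intro i h1 h2
      have hi : i < 2 * n := by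
        simp only [List.length_map, List.length_append, List.length_ofFn] at h1
        omega
      simp only [List.getElem_map, List.getElem_take, List.getElem_drop, List.getElem_range,
        List.getElem_append, List.length_ofFn, List.getElem_ofFn]
      rw [hYb' (k + i) (by omega) (by omega)]
      split_ifs with h3
      · rfl
      · obtain ⟨m, rfl⟩ : ∃ m, i = m + n := ⟨i - n, by omega⟩
        rw [Nat.add_sub_cancel, ← add_assoc, hb]

theorem isPeriodOf_of_periodic {a : ℤ → ℕ} {n : ℕ} (hn : 0 < n) (hpos : ∀ j, 0 < a j)
    (ha : ∀ j, a (j + n) = a j) (k s : ℤ) :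
    IsPeriodOf (List.ofFn (fun i : Fin n => a (k + (i : ℕ)))) (fun j => (a (j + s) : ℚ)) := by
  have hq : ∀ q j : ℤ, a (j + q * n) = a j := by
    intro q
    induction q using Int.induction_on with
    | zero => simp
    | succ q ih =>
      intro j
      rw [add_mul, one_mul, ← add_assoc, ha, ih]
    | pred q ih =>
      intro j
      rw [← ha, ← ih j]
      congr 1
      ring
  refine ⟨?_, ?_, k - s, ?_⟩
  · intro h
    have := congrArg List.length h
    simp at this
    omega
  · intro x hx
    obtain ⟨i, rfl⟩ := List.mem_ofFn.1 hx
    exact hpos _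
  · intro q i
    simp only [List.get_eq_getElem, List.getElem_ofFn, List.length_ofFn]
    rw [← hq q (k + (i : ℕ))]
    congr 2
    ring

theorem IsIrrationalFrame.neg_left {f g : IntPt →+ ℝ} {c : ℝ} (h : IsIrrationalFrame f g c) :
    IsIrrationalFrame (-f) g (-c) where
  eq_zero_left x hx := h.eq_zero_left x (by simpa using hx)
  eq_zero_right := h.eq_zero_right
  ne_zero := neg_ne_zero.2 h.ne_zero
  wedge x y := by
    have := h.wedge x y
    simp only [AddMonoidHom.neg_apply]
    linarith

theorem IsIrrationalFrame.neg {f g : IntPt →+ ℝ} {c : ℝ} (h : IsIrrationalFrame f g c) :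
    IsIrrationalFrame (-f) (-g) c where
  eq_zero_left x hx := h.eq_zero_left x (by simpa using hx)
  eq_zero_right x hx := h.eq_zero_right x (by simpa using hx)
  ne_zero := h.ne_zero
  wedge x y := by
    have := h.wedge x y
    simp only [AddMonoidHom.neg_apply]
    linarith

/-- Each window of length `n` in the partial quotients is an LLS period: the four sails are the
even and the odd part of the bichain and their opposites. -/
theorem IsBichain.isLLSPeriod {M : Matrix (Fin 2) (Fin 2) ℤ} {F G : RealPt →ₗ[ℝ] ℝ} {c : ℝ}
    {σ : ℤ} {v : ℤ → IntPt} {a : ℤ → ℕ}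
    (h : IsBichain (latticeForm F) (latticeForm G) σ v a)
    (hfg : IsIrrationalFrame (latticeForm F) (latticeForm G) c) {n : ℕ} (hn : 0 < n)
    (hN : ∀ j, act (M ^ 2) (v j) = v (j + 2 * n)) (ha : ∀ j, a (j + n) = a j)
    (hcone : ∀ C, IsAssociatedCone M C →
      ∃ p q : ℝ, p ≠ 0 ∧ q ≠ 0 ∧ ∀ x, x ∈ C ↔ 0 ≤ p * F x ∧ 0 ≤ q * G x) (k : ℤ) :
    IsLLSPeriod M (List.ofFn (fun i : Fin n => a (k + (i : ℕ)))) := by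
  -- it suffices to find in the cone a bichain with the same partial quotients up to a shift
  have key : ∀ {C : Set RealPt} {f' g' : IntPt →+ ℝ} {c' : ℝ} {σ' : ℤ} {v' : ℤ → IntPt} {s : ℤ},
      IsBichain f' g' σ' v' (fun j => a (j + s)) → IsIrrationalFrame f' g' c' →
      (∀ x, toReal x ∈ C ↔ 0 ≤ f' x ∧ 0 ≤ g' x) →
      (∀ j, act (M ^ 2) (v' j) = v' (j + 2 * n)) →
      ∃ A : ℤ → IntPt, IsSailLine C Set.univ A ∧
        (∀ i : ℤ, (M ^ 2).mulVec (A i) =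
          A (i + ((List.ofFn (fun i : Fin n => a (k + (i : ℕ)))).length : ℤ))) ∧
        IsPeriodOf (List.ofFn (fun i : Fin n => a (k + (i : ℕ)))) (absLLS A) := by
    intro C f' g' c' σ' v' s h' hfg' hC' hN'
    refine ⟨fun k => v' (2 * k), h'.isSailLine hfg' hC', fun i => ?_, ?_⟩
    · rw [List.length_ofFn]
      simp only [mul_add]
      exact hN' _
    · rw [show absLLS (fun k => v' (2 * k)) = fun j => (a (j + s) : ℚ) from
        funext fun j => h'.absLLS_eq j]
      exact isPeriodOf_of_periodic hn h.pos ha k s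
  have h0 : IsBichain (latticeForm F) (latticeForm G) σ v (fun j => a (j + 0)) := by
    simpa only [add_zero] using h
  have hneg : ∀ x, act (M ^ 2) (-x) = -act (M ^ 2) x := fun x => Matrix.mulVec_neg _ _
  have hN1 : ∀ j, act (M ^ 2) (v (j + 1)) = v (j + 2 * n + 1) := fun j => by
    rw [hN, add_right_comm]
  have hsign : ∀ {p : ℝ} (y : ℝ), p < 0 → (0 ≤ p * y ↔ 0 ≤ -y) := fun y hp => by
    rw [← neg_mul_neg, mul_nonneg_iff_of_pos_left (neg_pos.2 hp)]
  intro C hC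
  obtain ⟨p, q, hp, hq, hpq⟩ := hcone C hC
  rcases hp.lt_or_gt with hp | hp <;> rcases hq.lt_or_gt with hq | hq
  · refine key h0.neg hfg.neg (fun x => ?_) (fun j => by rw [hneg, hN])
    rw [hpq, hsign _ hp, hsign _ hq]
    simp
  · refine key h.succ hfg.neg_left (fun x => ?_) hN1
    rw [hpq, hsign _ hp, mul_nonneg_iff_of_pos_left hq]
    simp
  · refine key h.succ.neg hfg.neg_left.neg (fun x => ?_) (fun j => by rw [hneg, hN1])
    rw [hpq, mul_nonneg_iff_of_pos_left hp, hsign _ hq]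
    simp
  · refine key h0 hfg (fun x => ?_) hN
    rw [hpq, mul_nonneg_iff_of_pos_left hp, mul_nonneg_iff_of_pos_left hq]
    simp

theorem IsChain.isAngleLLS {σ : ℤ} {A e : ℤ → IntPt} {m n : ℤ} (h : IsChain σ A e m n)
    (hmn : m < n) {P Q : IntPt} {p q : ℤ} (hp : 0 < p) (hq : 0 < q) (hP : P = p • A m)
    (hQ : Q = q • A n) {L : ℕ} (hL : 2 * (n - m) - 1 = L) :
    IsAngleLLS P Q ((List.range L).map (fun j : ℕ => absLLS (fun k => A (k + m)) j)) := by
  obtain ⟨N, hN⟩ := Int.eq_ofNat_of_zero_le (show 0 ≤ n - m by omega)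
  have hs := h.shift m
  rw [sub_self, hN] at hs
  have hn : (N : ℤ) + m = n := by omega
  have hpos : ∀ (p : ℤ) (x y : IntPt), 0 < p → y = p • x →
      ∃ t : ℝ, 0 < t ∧ toReal x = t • toReal y := by
    rintro p x y hp rfl
    have hpR : (0 : ℝ) < p := by exact_mod_cast hp
    refine ⟨(p : ℝ)⁻¹, by positivity, ?_⟩
    rw [toReal_zsmul, smul_smul, inv_mul_cancel₀ hpR.ne', one_smul]
  refine ⟨N, fun k => A (k + m), hs.isSailLine (by omega) hp hq (by simpa using hP)
    (by rw [hn]; exact hQ), ?_, ?_, ?_⟩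
  · simpa using hpos p _ P hp hP
  · simp only [hn]
    exact hpos q _ Q hq hQ
  · congr 2
    omega

theorem act_neg_matrix (M : Matrix (Fin 2) (Fin 2) ℤ) (x : IntPt) : act (-M) x = -act M x :=
  Matrix.neg_mulVec _ _

/-- The two-sided continued fraction on which a matrix with eigenforms `F`, `G` acts, up to sign,
by a shift. -/
theorem exists_isBichain_of_eigenforms {M : Matrix (Fin 2) (Fin 2) ℤ} {α β c : ℝ}
    {F G : RealPt →ₗ[ℝ] ℝ} (hdet : M.det = 1 ∨ M.det = -1) (hα : 1 < |α|) (hβ : β ≠ 0)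
    (hF : ∀ u, F (realOp M u) = β * F u) (hG : ∀ u, G (realOp M u) = α * G u)
    (hfg : IsIrrationalFrame (latticeForm F) (latticeForm G) c) :
    ∃ (n : ℕ) (σ : ℤ) (v : ℤ → IntPt) (a : ℤ → ℕ), 0 < n ∧
      IsBichain (latticeForm F) (latticeForm G) σ v a ∧
      (∀ j, act (M ^ 2) (v j) = v (j + 2 * n)) ∧ ∀ j, a (j + n) = a j := by
  -- of the matrices `M` and `-M` the one with a positive expanding eigenvalue shifts the bichain
  obtain ⟨M', α', β', hsq, hdet', hα', hβ', hF', hG'⟩ : ∃ (M' : Matrix (Fin 2) (Fin 2) ℤ)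
      (α' β' : ℝ), M' * M' = M ^ 2 ∧ (M'.det = 1 ∨ M'.det = -1) ∧ 1 < α' ∧ β' ≠ 0 ∧
      (∀ x, latticeForm F (act M' x) = β' * latticeForm F x) ∧
      ∀ x, latticeForm G (act M' x) = α' * latticeForm G x := by
    rcases lt_abs.1 hα with h | h
    · refine ⟨M, α, β, (sq M).symm, hdet, h, hβ, fun x => ?_, fun x => ?_⟩
      · rw [latticeForm_apply, toReal_act, hF, latticeForm_apply]
      · rw [latticeForm_apply, toReal_act, hG, latticeForm_apply]
    · refine ⟨-M, -α, -β, by rw [neg_mul_neg, sq], ?_, h, neg_ne_zero.2 hβ, fun x => ?_,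
        fun x => ?_⟩
      · simpa [Matrix.det_neg] using hdet
      · rw [act_neg_matrix, map_neg, latticeForm_apply, toReal_act, hF, latticeForm_apply, neg_mul]
      · rw [act_neg_matrix, map_neg, latticeForm_apply, toReal_act, hG, latticeForm_apply, neg_mul]
  obtain ⟨n, σ, v, a, hn, h, hv⟩ := exists_isBichain hfg hF' hG' hα' hβ' hdet'
  refine ⟨n, σ, v, a, hn, h, fun j => ?_, fun j => ?_⟩
  · rw [← hsq, act_mul, hv, hv]
    congr 1
    ring
  · have h1 := hv (j + 2)
    rw [h.step, act_add, act_smul, hv, hv, show j + 2 + (n : ℤ) = j + n + 2 by ring, h.step,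
      add_right_inj, add_right_comm] at h1
    have h2 : ((a j : ℤ) - a (j + n)) • v (j + n + 1) = 0 := by rw [sub_smul, h1, sub_self]
    rcases smul_eq_zero.1 h2 with h3 | h3
    · omega
    · exact absurd h3 (h.ne_zero _)

end LLS

theorem mainTheorem4 (M : Matrix.GeneralLinearGroup (Fin 2) ℤ)
    (hM : ∃ a b : ℝ, a ≠ b ∧ Irrational a ∧ Irrational b ∧
      (LLS.realOp (M : Matrix (Fin 2) (Fin 2) ℤ)).HasEigenvalue a ∧
      (LLS.realOp (M : Matrix (Fin 2) (Fin 2) ℤ)).HasEigenvalue b)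
    (P₀ : LLS.IntPt) (hP₀ : P₀ ≠ 0) (P₁ P₂ : LLS.IntPt)
    (hP₁ : P₁ = ((M : Matrix (Fin 2) (Fin 2) ℤ) ^ 4).mulVec P₀)
    (hP₂ : P₂ = ((M : Matrix (Fin 2) (Fin 2) ℤ) ^ 6).mulVec P₀) :
    ∃ (S₁ S₂ : List ℚ) (w : List ℕ),
      LLS.IsAngleLLS P₀ P₁ S₁ ∧ LLS.IsAngleLLS P₀ P₂ S₂ ∧
      LLS.IsLLSPeriod (M : Matrix (Fin 2) (Fin 2) ℤ) w ∧
      LLS.IsDifference S₂ S₁ ((w ++ w).map (fun x : ℕ => (x : ℚ))) := by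
  open LLS in
  have hdet : (M : Matrix (Fin 2) (Fin 2) ℤ).det = 1 ∨ (M : Matrix (Fin 2) (Fin 2) ℤ).det = -1 :=
    Int.isUnit_iff.1 ((Matrix.isUnit_iff_isUnit_det _).1 M.isUnit)
  generalize (M : Matrix (Fin 2) (Fin 2) ℤ) = M at *
  obtain ⟨m, P, hm, rfl, hP⟩ := exists_eq_smul_isCoprime hP₀
  have hP0 : P ≠ 0 := by
    rintro rfl
    simp at hP₀
  obtain ⟨α, β, c, F, G, hα, hβ, hne, hroots, hF, hG, hsep, hfg, hFP, hGP⟩ :=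
    exists_eigenforms hdet hM hP0
  obtain ⟨n, σ, v₀, a₀, hn, h₀, hN₀, ha₀⟩ :=
    exists_isBichain_of_eigenforms hdet hα hβ hF hG hfg
  -- number the bichain so that `P` lies between its vectors with indices `0` and `2`
  obtain ⟨i, hi1, hi2⟩ := h₀.exists_sector hfg (x := P) hFP.le hGP.le hP0
  obtain ⟨v, a, h, hN, ha, hs1, hs2⟩ : ∃ (v : ℤ → IntPt) (a : ℤ → ℕ),
      IsBichain (latticeForm F) (latticeForm G) σ v a ∧
      (∀ j, act (M ^ 2) (v j) = v (j + 2 * n)) ∧ (∀ j, a (j + n) = a j) ∧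
      0 ≤ σ * det2 (v 0) P ∧ 0 < σ * det2 P (v 2) := by
    refine ⟨_, _, h₀.shift i, fun j => ?_, fun j => ?_, by simpa using hi1, ?_⟩
    · rw [hN₀, add_right_comm]
    · rw [add_right_comm, ha₀]
    · rwa [show 2 + 2 * i = 2 * (i + 1) by ring]
  have hNdet : (M ^ 2).det = 1 := by
    rw [Matrix.det_pow]
    rcases hdet with h1 | h1 <;> simp [h1]
  have hnZ : (0 : ℤ) < n := by exact_mod_cast hn
  obtain ⟨l, r, B, E, hl, hr, hch, hBl, hBr, hBv, hBle, hBact⟩ :=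
    exists_angle_chains h hfg hNdet hnZ hN hP hFP hGP hs1 hs2
  have hper := fun k => h.isLLSPeriod hfg hn hN ha
    (fun C hC => hC.exists_signs hne hroots hF hG hsep) k
  obtain ⟨L, hL⟩ := Int.eq_ofNat_of_zero_le (show 0 ≤ 2 * (r + 2 * n - l) - 1 by omega)
  -- the position in both sequences of the entry of the edge from `v 2` to `v 4`, the first
  -- edge that both sails share with the sail of the cone
  obtain ⟨p, hp⟩ := Int.eq_ofNat_of_zero_le (show 0 ≤ 2 * (1 - l) by omega)
  have hact1 : ∀ x, act 1 x = x := fun x => Matrix.one_mulVec x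
  have hS₁ : IsAngleLLS (m • P) P₁
      ((List.range L).map (fun j : ℕ => absLLS (fun k => B 2 (k + l)) j)) := by
    refine (hch 2 le_rfl).isAngleLLS (by push_cast; omega) hm hm (by rw [hBl]) ?_
      (by push_cast; omega)
    rw [hBr 2 (by omega), ← pow_mul, hP₁, Matrix.mulVec_smul]
  have hS₂ : IsAngleLLS (m • P) P₂
      ((List.range (L + 2 * n)).map (fun j : ℕ => absLLS (fun k => B 3 (k + l)) j)) := by
    refine (hch 3 (by omega)).isAngleLLS (by push_cast; omega) hm hm (by rw [hBl]) ?_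
      (by push_cast; omega)
    rw [hBr 3 (by omega), ← pow_mul, hP₂, Matrix.mulVec_smul]
  have hXY : ∀ j : ℕ, j < p →
      absLLS (fun k => B 2 (k + l)) j = absLLS (fun k => B 3 (k + l)) j := by
    intro j hj
    have := absLLS_congr (A := fun k => B 3 (k + l)) (A' := fun k => B 2 (k + l)) (N := 1)
      (by simp) (s := 0) (j := j) fun i h1 h2 => by
        rw [hact1, add_zero]
        exact (hBle 2 _ (by push_cast; omega)).symm
    simpa using this
  have hYX : ∀ j : ℕ, p ≤ j →
      absLLS (fun k => B 3 (k + l)) (j + 2 * n : ℕ) = absLLS (fun k => B 2 (k + l)) j := by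
    intro j hj
    push_cast
    refine absLLS_congr hNdet fun i h1 h2 => ?_
    rw [add_right_comm]
    exact hBact 2 _ (by omega)
  have hYa : ∀ j : ℕ, p ≤ j → j < p + 2 * n →
      absLLS (fun k => B 3 (k + l)) j = a (j + 2 * l) := by
    intro j hj hj'
    rw [← h.absLLS_eq]
    symm
    refine absLLS_congr (A := fun k => B 3 (k + l)) (N := 1) (by simp) fun i h1 h2 => ?_
    rw [hact1]
    exact (hBv 3 _ (by omega) (by push_cast; omega)).symm
  have haℕ : ∀ j : ℕ, a ((j + n : ℕ) + 2 * l) = a (j + 2 * l) := by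
    intro j
    rw [← ha (j + 2 * l)]
    congr 1
    push_cast
    ring
  obtain ⟨k, hk⟩ := exists_isDifference (b := fun j : ℕ => a (j + 2 * l)) hn
    (show p ≤ L by omega) hXY hYX hYa haℕ
  refine ⟨_, _, _, hS₁, hS₂, hper (k + 2 * l), ?_⟩
  have e : (fun i : Fin n => a ((k : ℤ) + 2 * l + ((i : ℕ) : ℤ))) =
      fun i : Fin n => a (((k + (i : ℕ) : ℕ) : ℤ) + 2 * l) := by
    funext i
    congr 1
    push_cast
    ring
  rw [e]
  exact hk
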